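/- **Proposition A (Gromov seminorm and scl).** Let $X$ be a path-connected topological space with base point, let $G=\pi_1X$, and let $C_1^{\mathrm{conj}}(G;\mathbb{Z})$ be the quotient of the free abelian group $C_1(G;\mathbb{Z})=\bigoplus_{g\in G}\mathbb{Z}g$ by the subgroup spanned by the elements $w-t^{-1}wt$ with $w,t\in G$. Let $[c]\in C_1^{\mathrm{conj}}(G;\mathbb{Z})$ be represented by a map $\gamma=\coprod_{i\in I}\gamma_i:\coprod_{i\in I}S^1\to X$ with $I$ finite; that is, $[c]=\left[\sum_{i\in I}\lambda_iw_i\right]$ with $\lambda_i\in\mathbb{Z}\smallsetminus\{0\}$ and $w_i\in G$ pairwise non-conjugate, and for each $i$ the free homotopy class of $\gamma_i$ corresponds to the conjugacy class of $w_i^{\lambda_i}$. Then, in $[0,\infty]$ and with $\inf\emptyset=\infty$, $$\operatorname{scl}_{G}([c])=\frac14\inf\left\{\|\alpha\|_1\;\middle|\;\alpha\in H_2(X,\gamma;\mathbb{Q}),\ \partial\alpha=\left[\textstyle\coprod S^1\right]\right\}.$$ Here: - For $g\in G$, $\operatorname{cl}(g)\in\{0,1,\dots,\infty\}$ is the least number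 of commutators with product $g$ ($\infty$ if there is no such product); $\operatorname{cl}(g_1+\dots+g_m)=\inf_{t_1,\dots,t_m\in G}\operatorname{cl}\left(t_1g_1t_1^{-1}\cdots t_mg_mt_m^{-1}\right)$; and $\operatorname{scl}(g_1+\dots+g_m)=\liminf_{n\to\infty}\frac1n\operatorname{cl}(g_1^n+\dots+g_m^n)$, which is the limit along those $n$ for which $\operatorname{cl}$ is finite, and $\infty$ if there are no such $n\geq1$. For a class $[c]$, $\operatorname{scl}_G([c])$ is $\operatorname{scl}\left(\sum_g g^{c_g}\right)$, where $c=\sum_gc_gg\in C_1(G;\mathbb{Z})$ is any representative of $[c]$ and the sum is over the $g$ with $c_g\neq0$; it is part of the statement that the displayed equality holds for every choice of $c$. - $X_\gamma=\left(X\amalg\left(\coprod S^1\times[0,1]\right)\right)/\left((u,0)\sim\gamma(u)\right)$ is the mapping cylinder of $\gamma$, containing $\coprod S^1$ as $\coprod S^1\times\{1\}$, and $H_*(X,\gamma;R)=H_*\left(X_\gamma,\coprod S^1;R\right)$ is relative singular homology. - $\partial:H_2(X,\gamma;\mathbb{Q})\to H_1\left(\coprod S^1;\mathbb{Q}\right)$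 is the boundary map in the long exact sequence of the pair $\left(X_\gamma,\coprod S^1\right)$, and $\left[\coprod S^1\right]$ is the fundamental class. - $\|\alpha\|_1$ is the relative Gromov seminorm of the image of $\alpha$ in $H_2(X,\gamma;\mathbb{R})$: the infimum of $\sum_\sigma|a_\sigma|$ over all real singular $2$-chains $a=\sum_\sigma a_\sigma\sigma$ in $X_\gamma$ with boundary in $\coprod S^1$ that represent this image. -/

import Mathlib

open scoped ENNReal

set_option maxSynthPendingDepth 3

noncomputable section

namespace GromovScl

/-! ### Stable commutator length of integral chains on a group -/

section Algebra

variable {G : Type*} [Group G]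

/-- Commutator length: the least number of commutators whose product is `g`, and `∞` if `g` is not
a product of commutators. -/
def commLength (g : G) : ℕ∞ :=
  ⨅ (L : List (G × G)) (_ : (L.map fun p => p.1 * p.2 * p.1⁻¹ * p.2⁻¹).prod = g), (L.length : ℕ∞)

/-- Commutator length of a formal sum `g₁ + ⋯ + gₘ`: the infimum of the commutator lengths of all
products `g₁' ⋯ gₘ'` with `gᵢ'` conjugate to `gᵢ`. -/
def commLengthSum (L : List G) : ℕ∞ :=
  ⨅ (L' : List G) (_ : List.Forall₂ IsConj L L'), commLength L'.prod

/-- Stable commutator length of a formal sum `g₁ + ⋯ + gₘ`: the limit of `cl(g₁ⁿ + ⋯ + gₘⁿ) / n`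
along those `n` for which the numerator is finite, and `∞` if there are no such `n ≥ 1`.  (The
sequence is `∞` at all other `n ≥ 1`, so this is its lower limit.) -/
def sclSum (L : List G) : ℝ≥0∞ :=
  Filter.liminf (fun n : ℕ => ((commLengthSum (L.map (· ^ n)) : ℕ∞) : ℝ≥0∞) / (n : ℝ≥0∞))
    Filter.atTop

/-- Stable commutator length of an integral chain `∑ λ_g g`: that of the formal sum `∑ g ^ λ_g`. -/
def scl (c : G →₀ ℤ) : ℝ≥0∞ :=
  sclSum (c.support.toList.map fun g => g ^ c g)

variable (G) in
/-- The submodule `K(G; ℤ)` of `C₁(G; ℤ)` spanned by the differences `w - t⁻¹wt`. -/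
def conjSubmodule : Submodule ℤ (G →₀ ℤ) :=
  Submodule.span ℤ
    {κ | ∃ w t : G, κ = Finsupp.single w 1 - Finsupp.single (t⁻¹ * w * t) 1}

variable (G) in
/-- Integral conjugacy classes of chains on `G`. -/
abbrev ConjChains : Type _ := (G →₀ ℤ) ⧸ conjSubmodule G

/-- The class `[c]` of an integral chain `c`. -/
def conjClass (c : G →₀ ℤ) : ConjChains G := (conjSubmodule G).mkQ c

end Algebra

/-! ### Singular homology -/

section Singular

/-- Singular `n`-simplices. -/
abbrev SSimplex (n : ℕ) (Y : Type*) [TopologicalSpace Y] : Type _ :=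
  C(stdSimplex ℝ (Fin (n + 1)), Y)

/-- Singular `n`-chains with coefficients in `R`. -/
abbrev SChain (R : Type*) [CommRing R] (n : ℕ) (Y : Type*) [TopologicalSpace Y] : Type _ :=
  SSimplex n Y →₀ R

variable (R : Type*) [CommRing R] {Y Z : Type*} [TopologicalSpace Y] [TopologicalSpace Z]

/-- The `i`-th face of a singular simplex. -/
def face {n : ℕ} (i : Fin (n + 2)) (σ : SSimplex (n + 1) Y) : SSimplex n Y :=
  σ.comp ⟨stdSimplex.map i.succAbove, stdSimplex.continuous_map _⟩

variable (Y) in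
/-- The singular boundary map `Cₙ₊₁(Y; R) → Cₙ(Y; R)`. -/
def bd (n : ℕ) : SChain R (n + 1) Y →ₗ[R] SChain R n Y :=
  Finsupp.linearCombination R fun σ : SSimplex (n + 1) Y =>
    ∑ i : Fin (n + 2), (-1 : R) ^ (i : ℕ) • Finsupp.single (face i σ) (1 : R)

/-- The map on singular chains induced by a continuous map. -/
def push (n : ℕ) (f : C(Y, Z)) : SChain R n Y →ₗ[R] SChain R n Z :=
  Finsupp.lmapDomain R R fun σ : SSimplex n Y => f.comp σ

lemma bd_single {n : ℕ} (σ : SSimplex (n + 1) Y) (r : R) :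
    bd R Y n (Finsupp.single σ r) =
      r • ∑ i : Fin (n + 2), (-1 : R) ^ (i : ℕ) • Finsupp.single (face i σ) (1 : R) := by
  simp [bd]

lemma push_single {n : ℕ} (f : C(Y, Z)) (σ : SSimplex n Y) (r : R) :
    push R n f (Finsupp.single σ r) = Finsupp.single (f.comp σ) r := by
  simp [push]

lemma bd_push {n : ℕ} (f : C(Y, Z)) (a : SChain R (n + 1) Y) :
    bd R Z n (push R (n + 1) f a) = push R n f (bd R Y n a) := by
  induction a using Finsupp.induction_linear with
  | zero => simp
  | add a b ha hb => simp only [map_add, ha, hb]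
  | single σ r =>
    simp only [push_single, bd_single, map_smul, map_sum]
    rfl

lemma push_injective {n : ℕ} {f : C(Y, Z)} (hf : Function.Injective f) :
    Function.Injective (push R n f) :=
  Finsupp.mapDomain_injective fun _ _ h =>
    ContinuousMap.ext fun x => hf (DFunLike.congr_fun h x)

lemma face_face_swap {n : ℕ} (σ : SSimplex (n + 2) Y) (i : Fin (n + 3)) (j : Fin (n + 2)) :
    face (j.predAbove i) (face (i.succAbove j) σ) = face j (face i σ) := by
  ext x
  simp only [face, ContinuousMap.comp_apply, ContinuousMap.coe_mk, stdSimplex.map_comp_apply]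
  congr 2
  funext k
  exact Fin.succAbove_succAbove_succAbove_predAbove i j k

lemma bd_bd {n : ℕ} (a : SChain R (n + 2) Y) : bd R Y n (bd R Y (n + 1) a) = 0 := by
  induction a using Finsupp.induction_linear with
  | zero => simp
  | add a b ha hb => simp only [map_add, ha, hb, add_zero]
  | single σ r =>
    simp only [bd_single, map_smul, map_sum, one_smul, Finset.smul_sum]
    rw [← Finset.sum_product']
    refine Finset.sum_involution (fun p _ => (p.1.succAbove p.2, p.2.predAbove p.1)) ?_ ?_ ?_ ?_
    · rintro ⟨i, j⟩ -
      have h := Fin.neg_one_pow_succAbove_add_predAbove (R := R) i j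
      rw [pow_add, pow_add] at h
      simp only [face_face_swap, smul_smul, ← add_smul]
      rw [h]
      simp
    · rintro ⟨i, j⟩ - - h
      exact Fin.succAbove_ne i j (congrArg Prod.fst h)
    · simp
    · rintro ⟨i, j⟩ -
      exact Prod.ext (Fin.succAbove_succAbove_predAbove i j) (Fin.predAbove_predAbove_succAbove i j)

variable (Y) in
/-- Singular homology `Hₙ₊₁(Y; R)` (in positive degree `n + 1`). -/
abbrev Homology (n : ℕ) : Type _ :=
  LinearMap.ker (bd R Y n) ⧸
    (LinearMap.range (bd R Y (n + 1))).comap (LinearMap.ker (bd R Y n)).subtype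

variable {A : Type*} [TopologicalSpace A]

/-- The chains in `Cₙ₊₁(Y; R)` that are relative cycles for the pair given by `j : A → Y`, i.e.
whose boundary lies in (the image of) `Cₙ(A; R)`. -/
def relCycles (n : ℕ) (j : C(A, Y)) : Submodule R (SChain R (n + 1) Y) :=
  (LinearMap.range (push R n j)).comap (bd R Y n)

/-- The chains in `Cₙ₊₁(Y; R)` that vanish in relative homology: those of the form `∂b + e` with
`b ∈ Cₙ₊₂(Y; R)` and `e ∈ Cₙ₊₁(A; R)`. -/
def relBoundaries (n : ℕ) (j : C(A, Y)) : Submodule R (SChain R (n + 1) Y) :=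
  LinearMap.range (bd R Y (n + 1)) ⊔ LinearMap.range (push R (n + 1) j)

/-- Relative singular homology `Hₙ₊₁(Y, A; R)` (in positive degree `n + 1`) of the pair given by an
injective map `j : A → Y`. -/
abbrev RelHomology (n : ℕ) (j : C(A, Y)) : Type _ :=
  relCycles R n j ⧸ (relBoundaries R n j).comap (relCycles R n j).subtype

/-- The homology class of a relative cycle. -/
def relClass (n : ℕ) (j : C(A, Y)) : relCycles R n j →ₗ[R] RelHomology R n j :=
  Submodule.mkQ _

/-- The boundary of a relative cycle, as a chain in `A`. -/
def bdInSub (n : ℕ) {j : C(A, Y)} (hj : Function.Injective j) :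
    relCycles R n j →ₗ[R] SChain R n A :=
  (LinearEquiv.ofInjective (push R n j) (push_injective R hj)).symm.toLinearMap ∘ₗ
    (bd R Y n).restrict fun _ ha => ha

lemma push_bdInSub (n : ℕ) {j : C(A, Y)} (hj : Function.Injective j) (a : relCycles R n j) :
    push R n j (bdInSub R n hj a) = bd R Y n a := by
  have h := (LinearEquiv.ofInjective (push R n j) (push_injective R hj)).apply_symm_apply
    ((bd R Y n).restrict (fun _ ha => ha) a)
  exact congrArg Subtype.val h

lemma bd_bdInSub (n : ℕ) {j : C(A, Y)} (hj : Function.Injective j) (a : relCycles R (n + 1) j) :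
    bdInSub R (n + 1) hj a ∈ LinearMap.ker (bd R A n) := by
  apply push_injective R hj
  rw [← bd_push, push_bdInSub, bd_bd, map_zero]

/-- The connecting map `∂ : Hₙ₊₂(Y, A; R) → Hₙ₊₁(A; R)` of the long exact sequence of the pair,
`[a] ↦ [∂a]`. -/
def connecting (n : ℕ) {j : C(A, Y)} (hj : Function.Injective j) :
    RelHomology R (n + 1) j →ₗ[R] Homology R A n :=
  Submodule.mapQ _ _ ((bdInSub R (n + 1) hj).codRestrict _ (bd_bdInSub R n hj)) <| by
    intro a ha
    obtain ⟨_, ⟨b, rfl⟩, _, ⟨e, rfl⟩, h⟩ := Submodule.mem_sup.1 ha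
    refine ⟨e, push_injective R hj ?_⟩
    have h' : (bd R Y (n + 1)) (a : SChain R (n + 2) Y) = push R (n + 1) j (bd R A (n + 1) e) := by
      rw [← bd_push, show (a : SChain R (n + 2) Y) = _ from h.symm, map_add, bd_bd, zero_add]
    exact h'.symm.trans (push_bdInSub R (n + 1) hj a).symm

/-- The `ℓ¹`-norm of a singular chain. -/
def l1Norm {n : ℕ} (a : SChain ℝ n Y) : ℝ≥0∞ := a.sum fun _ r => ENNReal.ofReal |r|

/-- The `ℓ¹`-seminorm on relative homology with real coefficients. -/
def l1Seminorm {n : ℕ} {j : C(A, Y)} (α : RelHomology ℝ n j) : ℝ≥0∞ :=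
  ⨅ (a : relCycles ℝ n j) (_ : relClass ℝ n j a = α), l1Norm (a : SChain ℝ (n + 1) Y)

/-- Inclusion of rational chains into real chains. -/
def toRealChain (n : ℕ) : SChain ℚ n Y →ₛₗ[algebraMap ℚ ℝ] SChain ℝ n Y :=
  Finsupp.mapRange.linearMap (algebraMap ℚ ℝ).toSemilinearMap

lemma toRealChain_single {n : ℕ} (σ : SSimplex n Y) (r : ℚ) :
    toRealChain n (Finsupp.single σ r) = Finsupp.single σ (r : ℝ) := by
  simp [toRealChain]

lemma bd_toRealChain {n : ℕ} (a : SChain ℚ (n + 1) Y) :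
    bd ℝ Y n (toRealChain (n + 1) a) = toRealChain n (bd ℚ Y n a) := by
  induction a using Finsupp.induction_linear with
  | zero => simp
  | add a b ha hb => simp only [map_add, ha, hb]
  | single σ r =>
    simp [toRealChain_single, bd_single, map_smulₛₗ]

lemma push_toRealChain {n : ℕ} (f : C(Y, Z)) (a : SChain ℚ n Y) :
    push ℝ n f (toRealChain n a) = toRealChain n (push ℚ n f a) := by
  induction a using Finsupp.induction_linear with
  | zero => simp
  | add a b ha hb => simp only [map_add, ha, hb]
  | single σ r => simp only [toRealChain_single, push_single]

lemma toRealChain_mem {n : ℕ} {j : C(A, Y)} (a : relCycles ℚ n j) :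
    toRealChain (n + 1) (a : SChain ℚ (n + 1) Y) ∈ relCycles ℝ n j := by
  obtain ⟨a, e, he⟩ := a
  exact ⟨toRealChain n e, by rw [push_toRealChain, he, bd_toRealChain]⟩

/-- Inclusion of rational relative cycles into real relative cycles. -/
def toRealCycle (n : ℕ) (j : C(A, Y)) :
    relCycles ℚ n j →ₛₗ[algebraMap ℚ ℝ] relCycles ℝ n j :=
  ((toRealChain (n + 1)).comp (relCycles ℚ n j).subtype).codRestrict _ toRealChain_mem

/-- The change of coefficients `Hₙ₊₁(Y, A; ℚ) → Hₙ₊₁(Y, A; ℝ)`. -/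
def toRealClass (n : ℕ) (j : C(A, Y)) :
    RelHomology ℚ n j →ₛₗ[algebraMap ℚ ℝ] RelHomology ℝ n j :=
  Submodule.mapQ _ _ (toRealCycle n j) <| by
    intro a ha
    obtain ⟨_, ⟨b, rfl⟩, _, ⟨e, rfl⟩, h⟩ := Submodule.mem_sup.1 ha
    refine Submodule.mem_sup.2 ⟨_, ⟨toRealChain (n + 2) b, rfl⟩, _, ⟨toRealChain (n + 1) e, rfl⟩, ?_⟩
    rw [bd_toRealChain, push_toRealChain, ← map_add, h]
    rfl

end Singular

/-! ### Collections of loops and their mapping cylinders -/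

section Loops

/-- The disjoint union of circles indexed by `ι`. -/
abbrev Circles (ι : Type*) : Type _ := (_ : ι) × Circle

/-- The inclusion of the `i`-th circle. -/
def circleIncl {ι : Type*} (i : ι) : C(Circle, Circles ι) where
  toFun z := ⟨i, z⟩
  continuous_toFun := continuous_sigmaMk (σ := fun _ : ι => Circle)

/-- The loop `t ↦ exp(2πit)` based at `1` in the circle. -/
def circlePath : Path (1 : Circle) 1 where
  toFun t := Circle.exp (2 * Real.pi * t)
  continuous_toFun := by fun_prop
  source' := by simp
  target' := by simp

/-- The singular `1`-simplex in `∐ S¹` running once, in the positive direction, around the `i`-th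
circle. -/
def circleSimplex {ι : Type*} (i : ι) : SSimplex 1 (Circles ι) where
  toFun x := circleIncl i (Circle.exp (2 * Real.pi * (x : Fin 2 → ℝ) 1))
  continuous_toFun := (circleIncl i).continuous.comp <| Circle.exp.continuous.comp <|
    continuous_const.mul ((continuous_apply 1).comp continuous_subtype_val)

/-- The fundamental cycle of `∐ S¹`. -/
def circlesCycle (R : Type*) [CommRing R] (ι : Type*) [Fintype ι] : SChain R 1 (Circles ι) :=
  ∑ i : ι, Finsupp.single (circleSimplex i) 1

lemma circlesCycle_mem (R : Type*) [CommRing R] (ι : Type*) [Fintype ι] :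
    circlesCycle R ι ∈ LinearMap.ker (bd R (Circles ι) 0) := by
  have hface (i : ι) : face 0 (circleSimplex i) = face 1 (circleSimplex i) := by
    ext x : 1
    have hx : x = stdSimplex.vertex 0 := Subsingleton.elim _ _
    subst hx
    simp [face, circleSimplex, stdSimplex.map_vertex]
  simp [circlesCycle, bd_single, Fin.sum_univ_two, hface]

/-- The fundamental class `[∐ S¹] ∈ H₁(∐ S¹; R)`. -/
def circlesClass (R : Type*) [CommRing R] (ι : Type*) [Fintype ι] : Homology R (Circles ι) 0 :=
  Submodule.Quotient.mk ⟨circlesCycle R ι, circlesCycle_mem R ι⟩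

variable {X : Type*} [TopologicalSpace X] {ι : Type*}

/-- The gluing relation `(u, 0) ∼ γ(u)` of the mapping cylinder. -/
inductive CylRel (γ : C(Circles ι, X)) :
    X ⊕ (Circles ι × unitInterval) → X ⊕ (Circles ι × unitInterval) → Prop
  | glue (u : Circles ι) : CylRel γ (Sum.inr (u, 0)) (Sum.inl (γ u))

/-- The mapping cylinder `X_γ`, with the quotient topology. -/
abbrev Cyl (γ : C(Circles ι, X)) : Type _ := Quot (CylRel γ)

/-- The inclusion `∐ S¹ → X_γ`, `u ↦ (u, 1)`. -/
def cylTop (γ : C(Circles ι, X)) : C(Circles ι, Cyl γ) where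
  toFun u := Quot.mk _ (Sum.inr (u, 1))
  continuous_toFun := continuous_quot_mk.comp (by fun_prop)

lemma cylTop_injective (γ : C(Circles ι, X)) : Function.Injective (cylTop γ) := by
  classical
  let q : Cyl γ → Option (Circles ι) :=
    Quot.lift (Sum.elim (fun _ => none) fun p => if p.2 = 1 then some p.1 else none) <| by
      rintro _ _ ⟨u⟩
      simp
  intro u v h
  have h' : q (cylTop γ u) = q (cylTop γ v) := congrArg q h
  simpa [q, cylTop] using h'

/-- The element of `π₁(X, x₀)` given by a map `S¹ → X` sending `1` to `x₀`. -/
def loopClass {x₀ : X} (f : C(Circle, X)) (hf : f 1 = x₀) : FundamentalGroup X x₀ :=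
  FundamentalGroup.fromPath
    (Path.Homotopic.Quotient.mk ((circlePath.map f.continuous).cast hf.symm hf.symm))

/-- The free homotopy class of the loop `f` corresponds to the conjugacy class of `g`: up to a free
homotopy, `f` is a loop based at `x₀` in the class `g`. -/
def LoopCorresponds {x₀ : X} (f : C(Circle, X)) (g : FundamentalGroup X x₀) : Prop :=
  ∃ (f' : C(Circle, X)) (hf' : f' 1 = x₀), f.Homotopic f' ∧ loopClass f' hf' = g

/-- The collection of loops `γ` represents the integral conjugacy class `x`: there is a standard
representative `∑ᵢ λᵢ wᵢ` of `x`, with nonzero `λᵢ` and pairwise non-conjugate `wᵢ`, such that the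
`i`-th loop of `γ` corresponds to the conjugacy class of `wᵢ ^ λᵢ`. -/
def Represents [Fintype ι] {x₀ : X} (γ : C(Circles ι, X))
    (x : ConjChains (FundamentalGroup X x₀)) : Prop :=
  ∃ (w : ι → FundamentalGroup X x₀) (l : ι → ℤ),
    (∀ i, l i ≠ 0) ∧ (∀ i k, i ≠ k → ¬ IsConj (w i) (w k)) ∧
    conjClass (∑ i, Finsupp.single (w i) (l i)) = x ∧
    ∀ i, LoopCorresponds (γ.comp (circleIncl i)) (w i ^ l i)

/-- The homology `H₂(X, γ; R) = H₂(X_γ, ∐ S¹; R)` of the pair `(X, γ)`. -/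
abbrev H2 (R : Type*) [CommRing R] (γ : C(Circles ι, X)) : Type _ :=
  RelHomology R 1 (cylTop γ)

/-- The boundary map `∂ : H₂(X, γ; R) → H₁(∐ S¹; R)`. -/
def H2.boundary (R : Type*) [CommRing R] (γ : C(Circles ι, X)) :
    H2 R γ →ₗ[R] Homology R (Circles ι) 0 :=
  connecting R 0 (cylTop_injective γ)

/-- The relative Gromov seminorm of a rational class, seen as a real class. -/
def gromovNorm (γ : C(Circles ι, X)) (α : H2 ℚ γ) : ℝ≥0∞ :=
  l1Seminorm (toRealClass 1 (cylTop γ) α)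

end Loops

end GromovScl

end

/-!
Gluing the triangles of a bar `2`-chain that bounds `g₁ⁿ + ⋯ + gₘⁿ` gives a surface with boundary,
and an Euler characteristic count shows that a filling of norm `r` writes a product of conjugates of
the `gᵢⁿ` with about `r / 4` commutators. Conversely, a product of `k` commutators has a filling of
norm `4 * k` up to an error linear in the number `m` of boundary circles. After dividing by `n` the
errors disappear, so `scl` is a quarter of the stable filling norm, and real chains do as well as
rational ones since `ℚ` is approximately a `ℚ`-linear retract of `ℝ` through a Hamel basis.

A relative cycle of `(X_γ, ∐ S¹)` is turned into a bar chain by joining the base point to its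
vertices, in `K` ways at the vertices on the circles, which differ by winding around the circle.
Averaging over all choices makes the part of the cycle inside `∐ S¹` contribute `O(K)` instead of
`O(K²)`, so that the relative norm alone bounds the stable filling norm. In the other direction, a
filling of the powers `gᵢⁿ` is realized by singular triangles in `X`, and completed by two triangles
in each cylinder, which contribute nothing in the limit.
-/

noncomputable section

namespace GromovScl

/-! ### Commutator length of formal sums -/

section CommutatorLength

variable {G : Type*} [Group G] {L M : List G} {g h x y : G}

lemma exists_prod_commutators_eq {k : ℕ} (hg : commLength g ≤ k) :
    ∃ T : List (G × G), T.length ≤ k ∧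
      (T.map fun p => p.1 * p.2 * p.1⁻¹ * p.2⁻¹).prod = g := by
  have hlt : commLength g < ((k + 1 : ℕ) : ℕ∞) :=
    hg.trans_lt (by exact_mod_cast k.lt_succ_self)
  simp only [commLength, iInf_lt_iff] at hlt
  obtain ⟨T, hT, hlen⟩ := hlt
  exact ⟨T, Nat.lt_succ_iff.1 (by exact_mod_cast hlen), hT⟩

lemma commLength_one : commLength (1 : G) = 0 :=
  nonpos_iff_eq_zero.1 ((iInf₂_le ([] : List (G × G)) (by simp)).trans_eq (by simp))

lemma commLength_commutator_le (a b : G) : commLength (a * b * a⁻¹ * b⁻¹) ≤ 1 :=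
  iInf₂_le [(a, b)] (by simp)

lemma commLength_mul_le (g h : G) : commLength (g * h) ≤ commLength g + commLength h := by
  induction hg : commLength g using ENat.recTopCoe with
  | top => simp
  | coe k =>
    induction hh : commLength h using ENat.recTopCoe with
    | top => simp
    | coe l =>
      obtain ⟨S, hS, rfl⟩ := exists_prod_commutators_eq hg.le
      obtain ⟨T, hT, rfl⟩ := exists_prod_commutators_eq hh.le
      exact (iInf₂_le (S ++ T) (by simp)).trans (by exact_mod_cast
        (List.length_append.trans_le (Nat.add_le_add hS hT)))

lemma exists_commLengthSum_eq (L : List G) :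
    ∃ L' : List G, List.Forall₂ IsConj L L' ∧ commLength L'.prod = commLengthSum L := by
  have : Nonempty {L' // List.Forall₂ IsConj L L'} := ⟨L, List.forall₂_same.2 fun _ _ => .refl _⟩
  obtain ⟨⟨L', hL'⟩, h⟩ :=
    ciInf_mem fun L' : {L' // List.Forall₂ IsConj L L'} => commLength L'.1.prod
  exact ⟨L', hL', h.trans iInf_subtype⟩

lemma commLengthSum_le {L' : List G} (h : List.Forall₂ IsConj L L') :
    commLengthSum L ≤ commLength L'.prod :=
  iInf₂_le L' h

lemma commLengthSum_nil : commLengthSum ([] : List G) = 0 :=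
  le_antisymm ((commLengthSum_le .nil).trans_eq commLength_one) zero_le

lemma forall₂_isConj_trans {N : List G} (h : List.Forall₂ IsConj L M)
    (h' : List.Forall₂ IsConj M N) : List.Forall₂ IsConj L N := by
  induction h generalizing N with
  | nil => exact h'
  | cons hxy _ ih =>
    obtain _ | ⟨hyz, h'⟩ := h'
    exact .cons (hxy.trans hyz) (ih h')

lemma commLengthSum_congr (h : List.Forall₂ IsConj L M) : commLengthSum L = commLengthSum M := by
  suffices key : ∀ {L M : List G}, List.Forall₂ IsConj L M → commLengthSum L ≤ commLengthSum M from
    (key h).antisymm (key (h.flip.imp fun _ _ h => IsConj.symm h))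
  intro L M h
  obtain ⟨M', hM', heq⟩ := exists_commLengthSum_eq M
  exact (commLengthSum_le (forall₂_isConj_trans h hM')).trans_eq heq

lemma commLengthSum_conj_cons (hxy : IsConj x y) :
    commLengthSum (x :: L) = commLengthSum (y :: L) :=
  commLengthSum_congr (.cons hxy (List.forall₂_same.2 fun _ _ => .refl _))

lemma commLengthSum_append_le (L M : List G) :
    commLengthSum (L ++ M) ≤ commLengthSum L + commLengthSum M := by
  obtain ⟨L', hL, hL'⟩ := exists_commLengthSum_eq L
  obtain ⟨M', hM, hM'⟩ := exists_commLengthSum_eq M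
  rw [← hL', ← hM']
  refine (commLengthSum_le (List.rel_append hL hM)).trans ?_
  rw [List.prod_append]
  exact commLength_mul_le _ _

lemma exists_forall₂_isConj_prod_eq_of_perm (hLM : L.Perm M) {L' : List G}
    (hL : List.Forall₂ IsConj L L') : ∃ M', List.Forall₂ IsConj M M' ∧ M'.prod = L'.prod := by
  induction hLM generalizing L' with
  | nil => exact ⟨L', hL, rfl⟩
  | cons a _ ih =>
    obtain _ | ⟨hab, hL⟩ := hL
    obtain ⟨M', hM, hprod⟩ := ih hL
    exact ⟨_ :: M', .cons hab hM, by simp only [List.prod_cons, hprod]⟩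
  | swap a b N =>
    obtain _ | @⟨_, b', _, _, hb, _ | @⟨_, a', _, N', ha, hN⟩⟩ := hL
    exact ⟨b' * a' * b'⁻¹ :: b' :: N', .cons (ha.trans (isConj_iff.2 ⟨b', rfl⟩)) (.cons hb hN),
      by simp [mul_assoc]⟩
  | trans _ _ ih₁ ih₂ =>
    obtain ⟨M', hM, hprod⟩ := ih₁ hL
    obtain ⟨N', hN, hprod'⟩ := ih₂ hM
    exact ⟨N', hN, hprod'.trans hprod⟩

lemma commLengthSum_perm (h : L.Perm M) : commLengthSum L = commLengthSum M := by
  suffices key : ∀ {L M : List G}, L.Perm M → commLengthSum L ≤ commLengthSum M from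
    (key h).antisymm (key h.symm)
  intro L M h
  obtain ⟨M', hM, heq⟩ := exists_commLengthSum_eq M
  obtain ⟨L', hL, hprod⟩ := exists_forall₂_isConj_prod_eq_of_perm h.symm hM
  exact (commLengthSum_le hL).trans_eq (hprod ▸ heq)

lemma commLengthSum_one_cons (L : List G) : commLengthSum (1 :: L) = commLengthSum L := by
  apply le_antisymm
  · simpa [commLengthSum_nil, commLength_one] using (commLengthSum_append_le [1] L).trans
      (add_le_add_left (commLengthSum_le (.cons (.refl 1) .nil)) _)
  · obtain ⟨_, _ | @⟨_, z, _, L', hz, hL⟩, heq⟩ := exists_commLengthSum_eq (1 :: L)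
    rw [← heq, isConj_one_right.1 hz, List.prod_cons, one_mul]
    exact commLengthSum_le hL

lemma commLengthSum_cons_cons_le (x y : G) (L : List G) :
    commLengthSum (x :: y :: L) ≤ commLengthSum (x * y :: L) := by
  obtain ⟨_, _ | @⟨_, z, _, L', hz, hL⟩, heq⟩ := exists_commLengthSum_eq (x * y :: L)
  obtain ⟨t, rfl⟩ := isConj_iff.1 hz
  refine (commLengthSum_le (L' := t * x * t⁻¹ :: t * y * t⁻¹ :: L') (.cons (isConj_iff.2 ⟨t, rfl⟩)
    (.cons (isConj_iff.2 ⟨t, rfl⟩) hL))).trans_eq (Eq.trans ?_ heq)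
  simp [mul_assoc]

lemma commLengthSum_cons_le_commutator_mul_cons (a b x : G) (L : List G) :
    commLengthSum (x :: L) ≤ commLengthSum (a * b * a⁻¹ * b⁻¹ * x :: L) + 1 := by
  obtain ⟨_, _ | @⟨_, z, _, L', hz, hL⟩, heq⟩ :=
    exists_commLengthSum_eq (a * b * a⁻¹ * b⁻¹ * x :: L)
  obtain ⟨t, rfl⟩ := isConj_iff.1 hz
  have hprod : (t * x * t⁻¹ :: L').prod = (t * b * t⁻¹) * (t * a * t⁻¹) * (t * b * t⁻¹)⁻¹ *
      (t * a * t⁻¹)⁻¹ * (t * (a * b * a⁻¹ * b⁻¹ * x) * t⁻¹ :: L').prod := by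
    simp only [List.prod_cons]
    group
  calc commLengthSum (x :: L) ≤ commLength (t * x * t⁻¹ :: L').prod :=
        commLengthSum_le (.cons (isConj_iff.2 ⟨t, rfl⟩) hL)
    _ ≤ 1 + commLength (t * (a * b * a⁻¹ * b⁻¹ * x) * t⁻¹ :: L').prod := by
        rw [hprod]
        exact (commLength_mul_le _ _).trans (add_le_add_left (commLength_commutator_le _ _) _)
    _ = commLengthSum (a * b * a⁻¹ * b⁻¹ * x :: L) + 1 := by rw [heq, add_comm]

lemma commLengthSum_mul_cons_le (x y : G) (L : List G) :
    commLengthSum (x * y :: L) ≤ commLengthSum (x :: y :: L) + 1 := by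
  obtain ⟨_, _ | @⟨_, _, _, _, hx, _ | @⟨_, _, _, L', hy, hL⟩⟩, heq⟩ :=
    exists_commLengthSum_eq (x :: y :: L)
  obtain ⟨s, rfl⟩ := isConj_iff.1 hx
  obtain ⟨t, rfl⟩ := isConj_iff.1 hy
  -- `(sxs⁻¹)(tyt⁻¹)` and `sxys⁻¹` differ by a commutator, up to conjugation
  set a := s * y⁻¹ * s⁻¹ with ha
  set b := t * s⁻¹ with hb
  calc commLengthSum (x * y :: L)
      = commLengthSum (s * x * y * s⁻¹ :: L) :=
        commLengthSum_conj_cons (isConj_iff.2 ⟨s, by group⟩)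
    _ ≤ commLengthSum (a * b * a⁻¹ * b⁻¹ * (s * x * y * s⁻¹) :: L) + 1 :=
        commLengthSum_cons_le_commutator_mul_cons ..
    _ = commLengthSum ((s * x * s⁻¹) * (t * y * t⁻¹) :: L) + 1 := by
        rw [commLengthSum_conj_cons (y := s * x * s⁻¹ * (t * y * t⁻¹))
          (isConj_iff.2 ⟨s * x * y * s⁻¹, by simp only [ha, hb]; group⟩)]
    _ ≤ commLengthSum (x :: y :: L) + 1 := by
        gcongr
        refine (commLengthSum_le (.cons (.refl _) hL)).trans_eq (Eq.trans ?_ heq)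
        simp only [List.prod_cons, mul_assoc]

end CommutatorLength

section Comparable

variable {G : Type*} [Group G] {L M N : List G}

/-- `L` and `M` are comparable if, inside every formal sum and uniformly in `n`, the `n`-th powers
of `L` cost at most a bounded amount more than those of `M`, and conversely. The ambient formal sum
makes this a congruence for concatenation. -/
def Comparable (L M : List G) : Prop :=
  ∃ C : ℕ, ∀ (n : ℕ) (N : List G),
    commLengthSum (L.map (· ^ n) ++ N) ≤ commLengthSum (M.map (· ^ n) ++ N) + C ∧
    commLengthSum (M.map (· ^ n) ++ N) ≤ commLengthSum (L.map (· ^ n) ++ N) + C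

namespace Comparable

lemma of_eq (h : ∀ (n : ℕ) (N : List G),
    commLengthSum (L.map (· ^ n) ++ N) = commLengthSum (M.map (· ^ n) ++ N)) : Comparable L M :=
  ⟨0, fun n N => by simp only [h n N, Nat.cast_zero, add_zero, le_refl, and_self]⟩

lemma of_perm (h : L.Perm M) : Comparable L M :=
  of_eq fun _ _ => commLengthSum_perm ((h.map _).append_right _)

@[symm]
lemma symm (h : Comparable L M) : Comparable M L :=
  let ⟨C, hC⟩ := h
  ⟨C, fun n N => (hC n N).symm⟩

@[trans]
lemma trans (h : Comparable L M) (h' : Comparable M N) : Comparable L N := by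
  obtain ⟨C, hC⟩ := h
  obtain ⟨D, hD⟩ := h'
  refine ⟨C + D, fun n K => ⟨?_, ?_⟩⟩
  · refine ((hC n K).1.trans (add_le_add_left (hD n K).1 _)).trans_eq ?_
    push_cast
    ring
  · refine ((hD n K).2.trans (add_le_add_left (hC n K).2 _)).trans_eq ?_
    push_cast
    ring

instance : Trans (Comparable (G := G)) Comparable Comparable := ⟨trans⟩

lemma append_left (h : Comparable L M) (K : List G) : Comparable (K ++ L) (K ++ M) := by
  obtain ⟨C, hC⟩ := h
  refine ⟨C, fun n N => ?_⟩
  have hswap (A : List G) : commLengthSum ((K ++ A).map (· ^ n) ++ N) =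
      commLengthSum (A.map (· ^ n) ++ (K.map (· ^ n) ++ N)) := by
    rw [List.map_append, ← List.append_assoc]
    exact commLengthSum_perm (List.perm_append_comm.append_right _)
  simpa only [hswap] using hC n (K.map (· ^ n) ++ N)

lemma append_right (h : Comparable L M) (K : List G) : Comparable (L ++ K) (M ++ K) :=
  ((of_perm List.perm_append_comm).trans (h.append_left K)).trans (of_perm List.perm_append_comm)

lemma of_forall₂_isConj (h : List.Forall₂ IsConj L M) : Comparable L M := by
  refine of_eq fun n N => commLengthSum_congr (List.rel_append ?_ ?_)
  · exact List.rel_map (fun _ _ hxy => hxy.pow n) h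
  · exact List.forall₂_same.2 fun _ _ => .refl _

lemma mul_of_commute {x y : G} (hxy : Commute x y) : Comparable [x, y] [x * y] := by
  refine ⟨1, fun n N => ?_⟩
  simp only [List.map_cons, List.map_nil, List.cons_append, List.nil_append, hxy.mul_pow]
  exact ⟨(commLengthSum_cons_cons_le _ _ _).trans le_self_add, commLengthSum_mul_cons_le _ _ _⟩

lemma one_nil : Comparable [(1 : G)] [] :=
  of_eq fun _ N => by simpa using commLengthSum_one_cons N

end Comparable

lemma liminf_le_liminf_of_le_add_div {f g : ℕ → ℝ≥0∞} {C : ℝ≥0∞} (hC : C ≠ ∞)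
    (h : ∀ n : ℕ, f n ≤ g n + C / n) :
    Filter.liminf f Filter.atTop ≤ Filter.liminf g Filter.atTop := by
  have hlim : Filter.Tendsto (fun n : ℕ => C / n) Filter.atTop (nhds 0) := by
    simpa using ENNReal.Tendsto.const_div ENNReal.tendsto_nat_nhds_top (.inr hC)
  refine le_of_forall_lt_imp_le_of_dense fun y hy =>
    ENNReal.le_of_forall_pos_le_add fun ε hε _ => ?_
  rw [← tsub_le_iff_right]
  refine Filter.le_liminf_of_le (by isBoundedDefault) ?_
  filter_upwards [Filter.eventually_lt_of_lt_liminf hy,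
    hlim.eventually_le_const (ENNReal.coe_pos.2 hε)] with n hyn hn
  exact tsub_le_iff_right.2 (hyn.le.trans ((h n).trans (by gcongr)))

lemma Comparable.sclSum_eq (h : Comparable L M) : sclSum L = sclSum M := by
  suffices key : ∀ {L M : List G}, Comparable L M → sclSum L ≤ sclSum M from
    (key h).antisymm (key h.symm)
  rintro L M ⟨C, hC⟩
  refine liminf_le_liminf_of_le_add_div (ENNReal.natCast_ne_top C) fun n => ?_
  have hn := (hC n []).1
  rw [List.append_nil, List.append_nil] at hn
  rw [← ENNReal.add_div]
  gcongr
  exact_mod_cast ENat.toENNReal_le.2 hn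

/-- The formal sum of the powers `κ ^ e κ` of chosen representatives of the conjugacy classes. -/
def normalForm (e : ConjClasses G →₀ ℤ) : List G :=
  e.support.toList.map fun κ => κ.out ^ e κ

lemma comparable_normalForm_erase (e : ConjClasses G →₀ ℤ) (κ : ConjClasses G) :
    Comparable (normalForm e) (κ.out ^ e κ :: normalForm (e.erase κ)) := by
  classical
  by_cases h : κ ∈ e.support
  · apply Comparable.of_perm
    have hsupp : e.support.toList.Perm (κ :: (e.erase κ).support.toList) := by
      rw [Finsupp.support_erase]
      conv_lhs => rw [← Finset.insert_erase h]
      exact Finset.toList_insert (Finset.notMem_erase κ _)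
    refine ((hsupp.map _).trans (.of_eq ?_) : (normalForm e).Perm _)
    rw [List.map_cons, normalForm]
    congr 1
    refine List.map_congr_left fun κ' hκ' => ?_
    rw [Finset.mem_toList, Finsupp.support_erase] at hκ'
    rw [Finsupp.erase_ne (Finset.ne_of_mem_erase hκ')]
  · rw [Finsupp.notMem_support_iff.1 h, Finsupp.erase_of_notMem_support h, zpow_zero]
    exact (Comparable.one_nil.append_right (normalForm e)).symm

lemma comparable_cons_normalForm (κ : ConjClasses G) (a : ℤ) (e : ConjClasses G →₀ ℤ) :
    Comparable (κ.out ^ a :: normalForm e) (normalForm (Finsupp.single κ a + e)) := by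
  have herase : (Finsupp.single κ a + e).erase κ = e.erase κ := by
    rw [Finsupp.erase_add, Finsupp.erase_single, zero_add]
  have hexp : κ.out ^ (Finsupp.single κ a + e) κ = κ.out ^ a * κ.out ^ e κ := by
    rw [Finsupp.add_apply, Finsupp.single_eq_same, zpow_add]
  calc Comparable (κ.out ^ a :: normalForm e)
        ([κ.out ^ a, κ.out ^ e κ] ++ normalForm (e.erase κ)) :=
        (comparable_normalForm_erase e κ).append_left [κ.out ^ a]
    Comparable _ ([κ.out ^ a * κ.out ^ e κ] ++ normalForm (e.erase κ)) :=
        (Comparable.mul_of_commute ((Commute.refl _).zpow_zpow _ _)).append_right _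
    Comparable _ (normalForm (Finsupp.single κ a + e)) := by
        simpa only [herase, hexp, List.cons_append, List.nil_append] using
          (comparable_normalForm_erase (Finsupp.single κ a + e) κ).symm

lemma comparable_normalForm_sum (P : List (G × ℤ)) :
    Comparable (P.map fun p => p.1 ^ p.2)
      (normalForm (P.map fun p => Finsupp.single (ConjClasses.mk p.1) p.2).sum) := by
  induction P with
  | nil => exact Comparable.of_perm (by simp [normalForm])
  | cons p P ih =>
    have hout : IsConj p.1 (ConjClasses.mk p.1).out :=
      ConjClasses.mk_eq_mk_iff_isConj.1 (Quotient.out_eq _).symm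
    have hpow : IsConj (p.1 ^ p.2) ((ConjClasses.mk p.1).out ^ p.2) := by
      obtain ⟨t, ht⟩ := isConj_iff.1 hout
      exact isConj_iff.2 ⟨t, by rw [← ht, conj_zpow]⟩
    rw [List.map_cons, List.map_cons, List.sum_cons]
    calc Comparable (p.1 ^ p.2 :: P.map fun p => p.1 ^ p.2)
          ([(ConjClasses.mk p.1).out ^ p.2] ++ P.map fun p => p.1 ^ p.2) :=
          (Comparable.of_forall₂_isConj (.cons hpow .nil)).append_right _
      Comparable _ _ := ih.append_left _
      Comparable _ _ := comparable_cons_normalForm _ _ _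

lemma mapDomain_mk_eq_of_conjClass_eq {c c' : G →₀ ℤ} (h : conjClass c = conjClass c') :
    c.mapDomain ConjClasses.mk = c'.mapDomain ConjClasses.mk := by
  have hker : conjSubmodule G ≤
      LinearMap.ker (Finsupp.lmapDomain ℤ ℤ (ConjClasses.mk (α := G))) := by
    refine Submodule.span_le.2 ?_
    rintro _ ⟨w, t, rfl⟩
    have hconj : ConjClasses.mk (t⁻¹ * w * t) = ConjClasses.mk w :=
      ConjClasses.mk_eq_mk_iff_isConj.2 (isConj_iff.2 ⟨t, by group⟩)
    rw [SetLike.mem_coe, LinearMap.mem_ker, map_sub]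
    simp [Finsupp.mapDomain_single, hconj]
  have hmem := LinearMap.mem_ker.1 (hker ((Submodule.Quotient.eq _).1 h))
  rwa [map_sub, sub_eq_zero] at hmem

lemma scl_eq_sclSum_of_conjClass_eq {ι : Type*} [Fintype ι] (w : ι → G) (l : ι → ℤ) (c : G →₀ ℤ)
    (h : conjClass (∑ i, Finsupp.single (w i) (l i)) = conjClass c) :
    scl c = sclSum (Finset.univ.toList.map fun i => w i ^ l i) := by
  have hc := comparable_normalForm_sum (c.support.toList.map fun g => (g, c g))
  have hw := comparable_normalForm_sum (Finset.univ.toList.map fun i => (w i, l i))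
  have hsum : ∑ i, Finsupp.single (ConjClasses.mk (w i)) (l i) = c.mapDomain ConjClasses.mk := by
    rw [← mapDomain_mk_eq_of_conjClass_eq h, Finsupp.mapDomain_finsetSum]
    simp only [Finsupp.mapDomain_single]
  simp only [List.map_map, Function.comp_def, Finset.sum_map_toList] at hc hw
  rw [hsum] at hw
  exact (hc.trans hw.symm).sclSum_eq

end Comparable

/-! ### Gluing polygons to surfaces -/

section Words

variable {G : Type*}

variable (G) in
/-- Labels of the sides of polygons: `inl (g, ε)` is an interior side, to be glued to some side
`inl (g, !ε)`, and `inr g` is a side on the boundary of the glued surface. -/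
abbrev Letter : Type _ := (G × Bool) ⊕ G

namespace Letter

/-- The element of the group read along a side; `false` reads it backwards. -/
def val [Group G] : Letter G → G
  | .inl (g, true) => g
  | .inl (g, false) => g⁻¹
  | .inr g => g

/-- The signed edge underlying an interior side; boundary sides do not count. -/
def edge : Letter G → (G →₀ ℤ)
  | .inl (g, true) => Finsupp.single g 1
  | .inl (g, false) => -Finsupp.single g 1
  | .inr _ => 0

/-- The label of a boundary side. -/
def bdry? : Letter G → Option G
  | .inl _ => none
  | .inr g => some g

end Letter

/-- The element of the group read around a polygon. -/
def wordVal [Group G] (W : List (Letter G)) : G := (W.map Letter.val).prod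

/-- The signed count of the interior sides of a polygon. -/
def wordEdges (W : List (Letter G)) : G →₀ ℤ := (W.map Letter.edge).sum

/-- The labels of the boundary sides of a polygon. -/
def wordBdry (W : List (Letter G)) : List G := W.filterMap Letter.bdry?

section Basic

variable (V W : List (Letter G)) (a : Letter G)

@[simp] lemma wordVal_nil [Group G] : wordVal ([] : List (Letter G)) = 1 := rfl

@[simp] lemma wordVal_cons [Group G] : wordVal (a :: W) = a.val * wordVal W := by simp [wordVal]

@[simp] lemma wordVal_append [Group G] : wordVal (V ++ W) = wordVal V * wordVal W := by
  simp [wordVal]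

@[simp] lemma wordEdges_nil : wordEdges ([] : List (Letter G)) = 0 := rfl

@[simp] lemma wordEdges_cons : wordEdges (a :: W) = a.edge + wordEdges W := by simp [wordEdges]

@[simp] lemma wordEdges_append : wordEdges (V ++ W) = wordEdges V + wordEdges W := by
  simp [wordEdges]

@[simp] lemma wordBdry_nil : wordBdry ([] : List (Letter G)) = [] := rfl

@[simp] lemma wordBdry_inl (p : G × Bool) : wordBdry (.inl p :: W) = wordBdry W := rfl

@[simp] lemma wordBdry_inr (g : G) : wordBdry (.inr g :: W) = g :: wordBdry W := rfl

@[simp] lemma wordBdry_append : wordBdry (V ++ W) = wordBdry V ++ wordBdry W := by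
  simp [wordBdry]

@[simp] lemma Letter.val_not [Group G] (g : G) (ε : Bool) :
    Letter.val (.inl (g, !ε)) = (Letter.val (.inl (g, ε)))⁻¹ := by
  cases ε <;> simp [Letter.val]

@[simp] lemma Letter.edge_not (g : G) (ε : Bool) :
    Letter.edge (.inl (g, !ε)) = -Letter.edge (.inl (g, ε)) := by
  cases ε <;> simp [Letter.edge]

end Basic

variable {V W : List (Letter G)}

lemma wordEdges_apply [DecidableEq G] (W : List (Letter G)) (g : G) :
    wordEdges W g = (W.countP (· = .inl (g, true)) : ℤ) - W.countP (· = .inl (g, false)) := by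
  induction W with
  | nil => simp
  | cons a W ih =>
    rw [wordEdges_cons, Finsupp.add_apply, ih]
    rcases a with ⟨h, _ | _⟩ | h <;> by_cases hg : h = g <;>
      simp [Letter.edge, hg] <;> ring

lemma exists_opposite_mem (h : wordEdges V + wordEdges W = 0) (hV : wordEdges V ≠ 0) :
    ∃ (g : G) (ε : Bool), .inl (g, ε) ∈ V ∧ .inl (g, !ε) ∈ W := by
  classical
  obtain ⟨g, hg⟩ := Finsupp.ne_iff.1 hV
  have hsum := DFunLike.congr_fun h g
  simp only [Finsupp.add_apply, wordEdges_apply, Finsupp.coe_zero, Pi.zero_apply] at hsum hg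
  have mem_of_countP_pos {U : List (Letter G)} {a : Letter G} (h : 0 < U.countP (· = a)) :
      a ∈ U := by
    simpa using List.countP_pos_iff.1 h
  rcases lt_or_gt_of_ne hg with hg | hg
  · refine ⟨g, false, mem_of_countP_pos (by omega), mem_of_countP_pos ?_⟩
    rw [Bool.not_false]
    omega
  · refine ⟨g, true, mem_of_countP_pos (by omega), mem_of_countP_pos ?_⟩
    rw [Bool.not_true]
    omega

lemma wordEdges_perm (h : V.Perm W) : wordEdges V = wordEdges W := (h.map _).sum_eq

lemma wordBdry_perm (h : V.Perm W) : (wordBdry V).Perm (wordBdry W) := h.filterMap _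

lemma isConj_wordVal_of_isRotated [Group G] (h : V ~r W) : IsConj (wordVal V) (wordVal W) := by
  obtain ⟨n, rfl⟩ := h
  rw [List.rotate_eq_drop_append_take_mod, wordVal_append]
  refine isConj_iff.2 ⟨(wordVal (V.take (n % V.length)))⁻¹, ?_⟩
  have hV := wordVal_append (V.take (n % V.length)) (V.drop (n % V.length))
  rw [List.take_append_drop] at hV
  rw [hV]
  group

lemma exists_isRotated_opposite {x : G} {ε : Bool} (hx : .inl (x, ε) ∈ W)
    (hW : wordEdges W = 0) :
    ∃ B C, (.inl (x, ε) :: (B ++ .inl (x, !ε) :: C)) ~r W ∧ wordEdges B + wordEdges C = 0 := by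
  obtain ⟨A, Z, rfl⟩ := List.append_of_mem hx
  have hrot : (.inl (x, ε) :: (Z ++ A)) ~r (A ++ .inl (x, ε) :: Z) :=
    List.isRotated_append (l := (.inl (x, ε) : Letter G) :: Z) (l' := A)
  rw [← wordEdges_perm hrot.perm, wordEdges_cons] at hW
  obtain ⟨g, δ, hg, hopp⟩ := exists_opposite_mem (V := [.inl (x, ε)]) (W := Z ++ A)
    (by simpa using hW) (by cases ε <;> simp [Letter.edge])
  obtain ⟨rfl, rfl⟩ : g = x ∧ δ = ε := by simpa using hg
  obtain ⟨B, C, hBC⟩ := List.append_of_mem hopp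
  rw [hBC] at hrot hW
  refine ⟨B, C, hrot, ?_⟩
  rw [wordEdges_append, wordEdges_cons, Letter.edge_not] at hW
  rw [← hW]
  abel

end Words

section Gluing

variable {G : Type*} [Group G] {V W : List (Letter G)} {k l : ℕ}

/-- The sides of the polygon `W` can be glued in pairs, up to `k` handles: cutting a disc labelled
by `W` out of a surface and inserting the boundary circles of `W` instead costs at most `k`
commutators. Each handle uses up two pairs of interior sides. -/
structure Glues (W : List (Letter G)) (k : ℕ) : Prop where
  length_le : 4 * k + (wordBdry W).length ≤ W.length
  commLengthSum_le : ∀ L : List G,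
    commLengthSum (wordBdry W ++ L) ≤ commLengthSum (wordVal W :: L) + k

namespace Glues

lemma of_isRotated (h : Glues V k) (hVW : V ~r W) : Glues W k where
  length_le := by
    rw [← hVW.perm.length_eq, ← (wordBdry_perm hVW.perm).length_eq]
    exact h.length_le
  commLengthSum_le L := by
    rw [← commLengthSum_perm ((wordBdry_perm hVW.perm).append_right L),
      ← commLengthSum_conj_cons (isConj_wordVal_of_isRotated hVW)]
    exact h.commLengthSum_le L

lemma of_forall_inl_notMem (hW : ∀ p, Sum.inl p ∉ W) : Glues W 0 where
  length_le := by simpa [wordBdry] using W.length_filterMap_le Letter.bdry?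
  commLengthSum_le L := by
    rw [Nat.cast_zero, add_zero]
    induction W generalizing L with
    | nil => exact (commLengthSum_one_cons L).ge
    | cons a W ih =>
      obtain p | g := a
      · exact absurd List.mem_cons_self (hW p)
      calc commLengthSum (g :: wordBdry W ++ L)
          = commLengthSum (wordBdry W ++ g :: L) := commLengthSum_perm List.perm_middle.symm
        _ ≤ commLengthSum (wordVal W :: g :: L) :=
          ih (fun p hp => hW p (List.mem_cons_of_mem _ hp)) _
        _ = commLengthSum (g :: wordVal W :: L) := commLengthSum_perm (.swap _ _ _)
        _ ≤ commLengthSum (wordVal (.inr g :: W) :: L) := by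
          rw [wordVal_cons]
          exact commLengthSum_cons_cons_le _ _ _

lemma planar (hV : Glues V k) (hW : Glues W l) (x : G) (ε : Bool) :
    Glues (.inl (x, ε) :: (V ++ .inl (x, !ε) :: W)) (k + l) where
  length_le := by
    have := hV.length_le
    have := hW.length_le
    simp only [wordBdry_inl, wordBdry_append, List.length_append, List.length_cons]
    omega
  commLengthSum_le L := by
    simp only [wordBdry_inl, wordBdry_append, wordVal_cons, wordVal_append, Letter.val_not]
    set X := Letter.val (.inl (x, ε))
    calc commLengthSum (wordBdry V ++ wordBdry W ++ L)
        = commLengthSum (wordBdry W ++ (wordBdry V ++ L)) := by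
          rw [← List.append_assoc]
          exact commLengthSum_perm (List.perm_append_comm.append_right _)
      _ ≤ commLengthSum (wordVal W :: (wordBdry V ++ L)) + l := hW.commLengthSum_le _
      _ = commLengthSum (wordBdry V ++ wordVal W :: L) + l := by
          rw [commLengthSum_perm List.perm_middle]
      _ ≤ commLengthSum (wordVal V :: wordVal W :: L) + k + l := by
          gcongr
          exact hV.commLengthSum_le _
      _ = commLengthSum (X * wordVal V * X⁻¹ :: wordVal W :: L) + (k + l : ℕ) := by
          rw [commLengthSum_conj_cons (isConj_iff.2 ⟨X, rfl⟩), Nat.cast_add, add_assoc]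
      _ ≤ commLengthSum (X * (wordVal V * (X⁻¹ * wordVal W)) :: L) + (k + l : ℕ) := by
          gcongr
          simpa only [mul_assoc] using
            commLengthSum_cons_cons_le (X * wordVal V * X⁻¹) (wordVal W) L

/-- Two crossing pairs of sides make a handle; cutting along both and regluing leaves a polygon
with four sides fewer. -/
lemma handle {B₁ B₂ C₁ C₂ : List (Letter G)} (h : Glues (C₂ ++ C₁ ++ B₂ ++ B₁) k)
    (x y : G) (ε δ : Bool) :
    Glues (.inl (x, ε) :: ((B₁ ++ .inl (y, δ) :: B₂) ++ .inl (x, !ε) ::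
      (C₁ ++ .inl (y, !δ) :: C₂))) (k + 1) where
  length_le := by
    have := h.length_le
    simp only [wordBdry_inl, wordBdry_append, List.length_append, List.length_cons] at this ⊢
    omega
  commLengthSum_le L := by
    have hle := h.commLengthSum_le L
    simp only [wordBdry_inl, wordBdry_append, wordVal_cons, wordVal_append, Letter.val_not]
      at hle ⊢
    set X := Letter.val (.inl (x, ε))
    set Y := Letter.val (.inl (y, δ))
    set b₁ := wordVal B₁
    set b₂ := wordVal B₂
    set c₁ := wordVal C₁
    set c₂ := wordVal C₂
    set d := c₁ * b₂ * b₁ with hd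
    set s := d⁻¹ * (X * b₁) with hs
    set t := Y * b₂ * b₁ with ht
    have hperm : (wordBdry B₁ ++ wordBdry B₂ ++ (wordBdry C₁ ++ wordBdry C₂) ++ L).Perm
        (wordBdry C₂ ++ wordBdry C₁ ++ wordBdry B₂ ++ wordBdry B₁ ++ L) := by
      classical
      simp only [List.perm_iff_count, List.count_append]
      omega
    rw [commLengthSum_perm hperm]
    calc _ ≤ commLengthSum (c₂ * c₁ * b₂ * b₁ :: L) + k := hle
      _ = commLengthSum (c₂ * d :: L) + k := by simp only [hd, mul_assoc]
      _ ≤ commLengthSum (s * t * s⁻¹ * t⁻¹ * (c₂ * d) :: L) + 1 + k := by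
          gcongr
          exact commLengthSum_cons_le_commutator_mul_cons ..
      _ = commLengthSum (X * (b₁ * (Y * b₂) * (X⁻¹ * (c₁ * (Y⁻¹ * c₂)))) :: L) + (k + 1 : ℕ) := by
          rw [commLengthSum_conj_cons (isConj_iff.2 ⟨d, rfl⟩), Nat.cast_add, Nat.cast_one,
            add_assoc, add_comm (k : ℕ∞)]
          congr 3
          simp only [hs, ht, hd]
          group

end Glues

lemma exists_glues (W : List (Letter G)) (hW : wordEdges W = 0) : ∃ k, Glues W k := by
  induction hn : W.length using Nat.strong_induction_on generalizing W with
  | _ n ih =>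
  subst hn
  by_cases hin : ∀ p, Sum.inl p ∉ W
  · exact ⟨0, .of_forall_inl_notMem hin⟩
  push Not at hin
  obtain ⟨⟨x, ε⟩, hx⟩ := hin
  obtain ⟨B, C, hrot, hBC⟩ := exists_isRotated_opposite hx hW
  have hlen := hrot.perm.length_eq
  simp only [List.length_append, List.length_cons] at hlen
  by_cases hB : wordEdges B = 0
  · obtain ⟨k, hk⟩ := ih B.length (by omega) B hB rfl
    obtain ⟨l, hl⟩ := ih C.length (by omega) C (by simpa [hB] using hBC) rfl
    exact ⟨k + l, (hk.planar hl x ε).of_isRotated hrot⟩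
  · obtain ⟨y, δ, hy, hy'⟩ := exists_opposite_mem hBC hB
    obtain ⟨B₁, B₂, rfl⟩ := List.append_of_mem hy
    obtain ⟨C₁, C₂, rfl⟩ := List.append_of_mem hy'
    simp only [List.length_append, List.length_cons] at hlen
    have hedges : wordEdges (C₂ ++ C₁ ++ B₂ ++ B₁) = 0 := by
      simp only [wordEdges_append, wordEdges_cons, Letter.edge_not] at hBC ⊢
      rw [← hBC]
      abel
    obtain ⟨k, hk⟩ := ih _ (by simp only [List.length_append]; omega) _ hedges rfl
    exact ⟨k + 1, (hk.handle x y ε δ).of_isRotated hrot⟩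

/-- A polygon whose sides spell a relation of the group. -/
structure IsPolygon (W : List (Letter G)) : Prop where
  wordVal_eq_one : wordVal W = 1
  two_le_length : 2 ≤ W.length

lemma IsPolygon.merge {A B C D : List (Letter G)} {y : G} {δ : Bool}
    (hV : IsPolygon (A ++ .inl (y, δ) :: B)) (hW : IsPolygon (C ++ .inl (y, !δ) :: D)) :
    IsPolygon (A ++ D ++ C ++ B) := by
  obtain ⟨hV1, hV2⟩ := hV
  obtain ⟨hW1, hW2⟩ := hW
  simp only [wordVal_append, wordVal_cons, Letter.val_not, List.length_append,
    List.length_cons] at hV1 hV2 hW1 hW2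
  have hDC : wordVal D * wordVal C = Letter.val (.inl (y, δ)) := by
    rw [eq_inv_of_mul_eq_one_left hW1]
    group
  refine ⟨?_, by simp only [List.length_append]; omega⟩
  rw [wordVal_append, wordVal_append, wordVal_append, mul_assoc (wordVal A), hDC, mul_assoc, hV1]

/-- The polygons of `WW` can be glued along their interior sides to a surface without spherical
components. The inequality estimates its genus by counting sides. -/
def GluesToSurface (WW : List (List (Letter G))) : Prop :=
  ∃ k : ℕ, 4 * k + 2 * WW.length ≤ WW.flatten.length + 2 * (wordBdry WW.flatten).length ∧
    commLengthSum (wordBdry WW.flatten) ≤ k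

lemma GluesToSurface.perm {VV WW : List (List (Letter G))} (h : GluesToSurface VV)
    (hVW : VV.Perm WW) : GluesToSurface WW := by
  obtain ⟨k, hlen, hk⟩ := h
  have hb := wordBdry_perm hVW.flatten
  refine ⟨k, ?_, ?_⟩
  · rwa [← hVW.length_eq, ← hVW.flatten.length_eq, ← hb.length_eq]
  · rwa [← commLengthSum_perm hb]

lemma GluesToSurface.cons {WW : List (List (Letter G))} (h : GluesToSurface WW)
    (hW : IsPolygon W) (hedges : wordEdges W = 0) : GluesToSurface (W :: WW) := by
  obtain ⟨k, hlen, hk⟩ := h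
  have hW2 := hW.two_le_length
  simp only [GluesToSurface, List.flatten_cons, wordBdry_append, List.length_append,
    List.length_cons]
  obtain hb | hb := eq_or_ne (wordBdry W) []
  · exact ⟨k, by simp only [hb, List.length_nil]; omega, by simpa [hb] using hk⟩
  · obtain ⟨l, hl⟩ := exists_glues W hedges
    have hbl := hl.length_le
    have hpos := List.length_pos_of_ne_nil hb
    have hcost := hl.commLengthSum_le []
    rw [List.append_nil, hW.wordVal_eq_one, commLengthSum_one_cons, commLengthSum_nil,
      zero_add] at hcost
    refine ⟨l + k, by omega, (commLengthSum_append_le _ _).trans ?_⟩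
    push_cast
    gcongr

lemma GluesToSurface.of_merge {WW : List (List (Letter G))} {A B C D : List (Letter G)} {y : G}
    {δ : Bool} (h : GluesToSurface ((A ++ D ++ C ++ B) :: WW)) :
    GluesToSurface ((A ++ .inl (y, δ) :: B) :: (C ++ .inl (y, !δ) :: D) :: WW) := by
  obtain ⟨k, hlen, hk⟩ := h
  have hperm : (wordBdry ((A ++ D ++ C ++ B) :: WW).flatten).Perm
      (wordBdry ((A ++ .inl (y, δ) :: B) :: (C ++ .inl (y, !δ) :: D) :: WW).flatten) := by
    classical
    simp only [List.perm_iff_count, List.flatten_cons, wordBdry_append, wordBdry_inl,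
      List.count_append]
    omega
  refine ⟨k, ?_, by rwa [← commLengthSum_perm hperm]⟩
  rw [hperm.length_eq] at hlen
  simp only [List.flatten_cons, List.length_append, List.length_cons] at hlen ⊢
  omega

lemma gluesToSurface (WW : List (List (Letter G))) (hWW : ∀ W ∈ WW, IsPolygon W)
    (hedges : wordEdges WW.flatten = 0) : GluesToSurface WW := by
  induction hn : WW.length generalizing WW with
  | zero =>
    obtain rfl := List.length_eq_zero_iff.1 hn
    exact ⟨0, by simp, commLengthSum_nil.le⟩
  | succ n ih =>
    obtain ⟨W, WW, rfl⟩ := List.exists_cons_of_length_eq_add_one hn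
    rw [List.length_cons, Nat.add_right_cancel_iff] at hn
    rw [List.forall_mem_cons] at hWW
    rw [List.flatten_cons, wordEdges_append] at hedges
    by_cases hW : wordEdges W = 0
    · exact (ih WW hWW.2 (by simpa [hW] using hedges) hn).cons hWW.1 hW
    obtain ⟨y, δ, hy, hy'⟩ := exists_opposite_mem hedges hW
    obtain ⟨V, hV, hyV⟩ := List.mem_flatten.1 hy'
    obtain ⟨r₁, r₂, rfl⟩ := List.append_of_mem hV
    obtain ⟨A, B, rfl⟩ := List.append_of_mem hy
    obtain ⟨C, D, rfl⟩ := List.append_of_mem hyV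
    have hpoly := hWW.2
    simp only [List.mem_append, List.mem_cons] at hpoly
    have hmerge : GluesToSurface ((A ++ D ++ C ++ B) :: (r₁ ++ r₂)) := by
      refine ih _ (List.forall_mem_cons.2 ⟨hWW.1.merge (hpoly _ (.inr (.inl rfl))), ?_⟩) ?_ ?_
      · exact fun U hU => hpoly U ((List.mem_append.1 hU).imp_right .inr)
      · simp only [List.flatten_cons, List.flatten_append, wordEdges_append, wordEdges_cons,
          Letter.edge_not] at hedges ⊢
        rw [← hedges]
        abel
      · simpa [← add_assoc] using hn
    exact hmerge.of_merge.perm (List.perm_middle.symm.cons _)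

end Gluing

/-! ### Fillings in the bar complex -/

section Norm

variable {S R : Type*} [CommRing R] [LinearOrder R]

/-- The `ℓ¹`-norm of a finitely supported function. -/
def norm1 (b : S →₀ R) : R := b.sum fun _ r => |r|

@[simp] lemma norm1_zero : norm1 (0 : S →₀ R) = 0 := rfl

variable [IsStrictOrderedRing R]

lemma norm1_nonneg (b : S →₀ R) : 0 ≤ norm1 b := Finset.sum_nonneg fun _ _ => abs_nonneg _

@[simp] lemma norm1_single (s : S) (r : R) : norm1 (Finsupp.single s r) = |r| := by
  simp [norm1]

lemma norm1_eq_sum (b : S →₀ R) {t : Finset S} (h : b.support ⊆ t) :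
    norm1 b = ∑ s ∈ t, |b s| :=
  Finsupp.sum_of_support_subset _ h _ (by simp)

lemma norm1_add_le (a b : S →₀ R) : norm1 (a + b) ≤ norm1 a + norm1 b := by
  classical
  rw [norm1_eq_sum (a + b) Finsupp.support_add, norm1_eq_sum a Finset.subset_union_left,
    norm1_eq_sum b Finset.subset_union_right, ← Finset.sum_add_distrib]
  exact Finset.sum_le_sum fun s _ => abs_add_le _ _

lemma norm1_smul (r : R) (a : S →₀ R) : norm1 (r • a) = |r| * norm1 a := by
  rw [norm1_eq_sum (r • a) Finsupp.support_smul, norm1_eq_sum a subset_rfl, Finset.mul_sum]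
  simp [abs_mul]

end Norm

section BarComplex

variable {G R : Type*} [Group G] [CommRing R]

variable (G R) in
/-- The boundary map from degree two to degree one in the bar complex. -/
def barBd : (G × G →₀ R) →ₗ[R] (G →₀ R) :=
  Finsupp.linearCombination R fun p =>
    Finsupp.single p.1 1 + Finsupp.single p.2 1 - Finsupp.single (p.1 * p.2) 1

lemma barBd_single (a b : G) (r : R) :
    barBd G R (Finsupp.single (a, b) r) =
      Finsupp.single a r + Finsupp.single b r - Finsupp.single (a * b) r := by
  simp [barBd, smul_sub]

lemma barBd_mapRange {S : Type*} [CommRing S] (f : R →+ S) (b : G × G →₀ R) :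
    barBd G S (Finsupp.mapRange.addMonoidHom f b) =
      Finsupp.mapRange.addMonoidHom f (barBd G R b) := by
  induction b using Finsupp.induction_linear with
  | zero => simp only [map_zero]
  | add a b ha hb => simp only [map_add, ha, hb]
  | single p r =>
    obtain ⟨x, y⟩ := p
    simp only [barBd_single, map_sub, map_add, Finsupp.mapRange.addMonoidHom_apply,
      Finsupp.mapRange_single]

end BarComplex

section Filling

variable {R S T M N : Type*} [CommRing R] [LinearOrder R] [AddCommGroup M] [Module R M]
  [AddCommGroup N] [Module R N]

/-- The element `c` bounds a chain of norm at most `r`, for a boundary map `d` on a based module. It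
is used for the bar complex of a group and for the singular chains of a space. -/
def HasFilling (d : (S →₀ R) →ₗ[R] M) (r : R) (c : M) : Prop := ∃ b, d b = c ∧ norm1 b ≤ r

namespace HasFilling

variable {d : (S →₀ R) →ₗ[R] M} {e : (T →₀ R) →ₗ[R] N} {r r' : R} {c c' : M}

lemma mono (h : HasFilling d r c) (hr : r ≤ r') : HasFilling d r' c :=
  h.imp fun _ hb => ⟨hb.1, hb.2.trans hr⟩

lemma zero : HasFilling d 0 0 := ⟨0, map_zero _, norm1_zero.le⟩

variable [IsStrictOrderedRing R]

lemma boundary_single (d : (S →₀ R) →ₗ[R] M) (s : S) : HasFilling d 1 (d (Finsupp.single s 1)) :=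
  ⟨_, rfl, by simp⟩

lemma add (h : HasFilling d r c) (h' : HasFilling d r' c') : HasFilling d (r + r') (c + c') := by
  obtain ⟨b, rfl, hb⟩ := h
  obtain ⟨b', rfl, hb'⟩ := h'
  exact ⟨b + b', map_add _ _ _, (norm1_add_le b b').trans (add_le_add hb hb')⟩

lemma smul (t : R) (h : HasFilling d r c) : HasFilling d (|t| * r) (t • c) := by
  obtain ⟨b, rfl, hb⟩ := h
  refine ⟨t • b, map_smul _ _ _, ?_⟩
  rw [norm1_smul]
  gcongr

lemma neg (h : HasFilling d r c) : HasFilling d r (-c) := by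
  simpa using h.smul (-1)

lemma sub (h : HasFilling d r c) (h' : HasFilling d r' c') : HasFilling d (r + r') (c - c') := by
  simpa only [sub_eq_add_neg] using h.add h'.neg

lemma sum {ι : Type*} {f : ι → R} {g : ι → M} (s : Finset ι)
    (h : ∀ i ∈ s, HasFilling d (f i) (g i)) : HasFilling d (∑ i ∈ s, f i) (∑ i ∈ s, g i) := by
  classical
  induction s using Finset.induction_on with
  | empty => exact zero
  | insert i s hi ih =>
    rw [Finset.sum_insert hi, Finset.sum_insert hi]
    exact (h i (Finset.mem_insert_self i s)).add
      (ih fun j hj => h j (Finset.mem_insert_of_mem hj))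

lemma apply_boundary {f : S → R} (φ : M →ₗ[R] N)
    (h : ∀ s, HasFilling e (f s) (φ (d (Finsupp.single s 1)))) (a : S →₀ R) :
    HasFilling e (a.sum fun s t => |t| * f s) (φ (d a)) := by
  have hφ : φ ∘ₗ d = Finsupp.linearCombination R fun s => φ (d (Finsupp.single s 1)) :=
    Finsupp.lhom_ext' fun s => LinearMap.ext_ring <| by simp
  rw [← LinearMap.comp_apply, hφ]
  exact sum _ fun s _ => (h s).smul (a s)

lemma map (φ : M →ₗ[R] N) (h : ∀ s, HasFilling e 1 (φ (d (Finsupp.single s 1))))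
    (hc : HasFilling d r c) : HasFilling e r (φ c) := by
  obtain ⟨b, rfl, hb⟩ := hc
  refine (apply_boundary φ h b).mono ?_
  simp only [mul_one]
  exact hb

end HasFilling

end Filling

section BarFilling

variable {G R : Type*} [Group G] [CommRing R] [LinearOrder R] [IsStrictOrderedRing R]

lemma hasFilling_triangle (x y : G) : HasFilling (barBd G R) 1
    (Finsupp.single x 1 + Finsupp.single y 1 - Finsupp.single (x * y) 1) :=
  barBd_single x y (1 : R) ▸ HasFilling.boundary_single (barBd G R) (x, y)

lemma hasFilling_single_one : HasFilling (barBd G R) 1 (Finsupp.single 1 1) := by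
  simpa using hasFilling_triangle (R := R) (1 : G) 1

end BarFilling

section ListChain

variable {G R : Type*} [CommRing R]

variable (R) in
/-- The formal sum `g₁ + ⋯ + gₘ` as a bar chain. -/
def listChain (L : List G) : G →₀ R := (L.map fun g => Finsupp.single g 1).sum

@[simp] lemma listChain_nil : listChain R ([] : List G) = 0 := rfl

@[simp] lemma listChain_cons (g : G) (L : List G) :
    listChain R (g :: L) = Finsupp.single g 1 + listChain R L := by
  simp [listChain]

lemma listChain_map_univ {ι : Type*} [Fintype ι] (w : ι → G) :
    listChain R (Finset.univ.toList.map w) = ∑ i, Finsupp.single (w i) 1 := by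
  rw [listChain, List.map_map]
  exact Finset.sum_map_toList _ _

lemma mapRange_listChain {S : Type*} [CommRing S] (f : R →+* S) (L : List G) :
    Finsupp.mapRange.addMonoidHom (f : R →+ S) (listChain R L) = listChain S L := by
  simp [listChain, map_list_sum, Function.comp_def, Finsupp.mapRange_single]

lemma listChain_flatMap_replicate (n : ℕ) (L : List G) :
    listChain R (L.flatMap (List.replicate n)) = n • listChain R L := by
  induction L with
  | nil => simp
  | cons g L ih =>
    rw [List.flatMap_cons, listChain_cons, smul_add, ← ih, listChain, listChain, List.map_append,
      List.sum_append, List.map_replicate, List.sum_replicate]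

end ListChain

section FillingsOfShortProducts

variable {G R : Type*} [Group G] [CommRing R] [LinearOrder R] [IsStrictOrderedRing R]

lemma hasFilling_single_sub_mul_commutator (d x y : G) :
    HasFilling (barBd G R) 4
      (Finsupp.single d 1 - Finsupp.single (d * (x * y * x⁻¹ * y⁻¹)) 1) := by
  set e := d * (x * y * x⁻¹ * y⁻¹) with he
  have hcomm : e * y * x = d * x * y := by simp only [he]; group
  have key := ((hasFilling_triangle (R := R) d x).add (hasFilling_triangle (d * x) y)).sub
    ((hasFilling_triangle e y).add (hasFilling_triangle (e * y) x))
  rw [hcomm] at key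
  convert key using 1
  · norm_num
  · abel

lemma hasFilling_one_sub_prod_commutators (T : List (G × G)) :
    HasFilling (barBd G R) (4 * T.length) (Finsupp.single 1 1 -
      Finsupp.single (T.map fun p => p.1 * p.2 * p.1⁻¹ * p.2⁻¹).prod 1) := by
  induction T using List.reverseRecOn with
  | nil => simpa using HasFilling.zero
  | append_singleton T p ih =>
    rw [List.map_append, List.map_singleton, List.prod_append, List.prod_singleton]
    set d := (T.map fun p => p.1 * p.2 * p.1⁻¹ * p.2⁻¹).prod
    convert ih.add (hasFilling_single_sub_mul_commutator d p.1 p.2) using 1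
    · simp only [List.length_append, List.length_singleton, Nat.cast_add, Nat.cast_one]
      ring
    · abel

lemma hasFilling_single_sub_conj (t x : G) :
    HasFilling (barBd G R) 2 (Finsupp.single x 1 - Finsupp.single (t * x * t⁻¹) 1) := by
  have key := (hasFilling_triangle (R := R) t x).sub (hasFilling_triangle (t * x * t⁻¹) t)
  rw [inv_mul_cancel_right] at key
  convert key using 1
  · norm_num
  · abel

lemma hasFilling_listChain_sub_prod {L L' : List G} (h : List.Forall₂ IsConj L L') :
    HasFilling (barBd G R) (3 * L.length + 1) (listChain R L - Finsupp.single L'.prod 1) := by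
  induction h with
  | nil => simpa using hasFilling_single_one.neg
  | @cons x x' L L' hx _ ih =>
    obtain ⟨t, rfl⟩ := isConj_iff.1 hx
    convert (ih.add (hasFilling_single_sub_conj t x)).add
      (hasFilling_triangle (t * x * t⁻¹) L'.prod) using 1
    · simp only [List.length_cons, Nat.cast_add, Nat.cast_one]
      ring
    · rw [listChain_cons, List.prod_cons]
      abel

lemma hasFilling_listChain {k : ℕ} {L : List G} (h : commLengthSum L ≤ k) :
    HasFilling (barBd G R) (4 * k + 3 * L.length + 2) (listChain R L) := by
  obtain ⟨L', hL, hL'⟩ := exists_commLengthSum_eq L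
  obtain ⟨T, hT, hprod⟩ := exists_prod_commutators_eq (hL'.trans_le h)
  have key := (hasFilling_listChain_sub_prod (R := R) hL).add
    (hasFilling_single_one.sub (hasFilling_one_sub_prod_commutators T))
  rw [hprod] at key
  convert key.mono (r' := 4 * (k : R) + 3 * L.length + 2) ?_ using 1
  · abel
  · have : (T.length : R) ≤ k := by exact_mod_cast hT
    linarith

end FillingsOfShortProducts

section ShortProductsFromFillings

variable {G : Type*}

lemma wordEdges_flatten (WW : List (List (Letter G))) :
    wordEdges WW.flatten = (WW.map wordEdges).sum := by
  simp only [wordEdges, List.map_flatten, List.sum_flatten, List.map_map]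
  rfl

lemma wordBdry_flatten (WW : List (List (Letter G))) :
    wordBdry WW.flatten = (WW.map wordBdry).flatten := by
  simp only [wordBdry, List.filterMap_flatten]
  rfl

variable [Group G]

/-- The triangle with sides `x`, `y` and `(xy)⁻¹`, or its mirror image. -/
def triangleWord (p : G × G) : Bool → List (Letter G)
  | true => [.inl (p.1, true), .inl (p.2, true), .inl (p.1 * p.2, false)]
  | false => [.inl (p.1 * p.2, true), .inl (p.2, false), .inl (p.1, false)]

lemma wordVal_triangleWord (p : G × G) (ε : Bool) : wordVal (triangleWord p ε) = 1 := by
  cases ε <;> simp [triangleWord, Letter.val]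

lemma length_triangleWord (p : G × G) (ε : Bool) : (triangleWord p ε).length = 3 := by
  cases ε <;> rfl

lemma wordBdry_triangleWord (p : G × G) (ε : Bool) : wordBdry (triangleWord p ε) = [] := by
  cases ε <;> rfl

lemma natAbs_nsmul_wordEdges_triangleWord (p : G × G) (n : ℤ) :
    n.natAbs • wordEdges (triangleWord p (0 < n)) = barBd G ℤ (Finsupp.single p n) := by
  rw [← natCast_zsmul, Int.natCast_natAbs, ← mul_one n, ← smul_eq_mul n 1, ← Finsupp.smul_single,
    map_smul, barBd_single, smul_eq_mul, mul_one]
  obtain hn | hn := lt_or_ge 0 n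
  · rw [abs_of_pos hn, decide_eq_true hn]
    simp [triangleWord, Letter.edge, sub_eq_add_neg, add_assoc]
  · rw [abs_of_nonpos hn, decide_eq_false hn.not_gt, neg_smul, ← smul_neg]
    simp only [triangleWord, wordEdges_cons, wordEdges_nil, Letter.edge]
    congr 1
    abel

lemma exists_triangles (z : G × G →₀ ℤ) : ∃ WW : List (List (Letter G)),
    (∀ W ∈ WW, ∃ p ε, W = triangleWord p ε) ∧ (WW.length : ℤ) = norm1 z ∧
      wordEdges WW.flatten = barBd G ℤ z := by
  refine ⟨z.support.toList.flatMap fun p =>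
    List.replicate (z p).natAbs (triangleWord p (0 < z p)), fun W hW => ?_, ?_, ?_⟩
  · obtain ⟨p, -, hW⟩ := List.mem_flatMap.1 hW
    exact ⟨p, _, List.eq_of_mem_replicate hW⟩
  · simp [List.length_flatMap, Finset.sum_map_toList, norm1, Finsupp.sum]
  · conv_rhs => rw [← z.sum_single, Finsupp.sum, map_sum, ← Finset.sum_map_toList]
    induction z.support.toList with
    | nil => simp
    | cons p l ih =>
      rw [List.flatMap_cons, List.flatten_append, wordEdges_append, ih, wordEdges_flatten,
        List.map_replicate, List.sum_replicate, natAbs_nsmul_wordEdges_triangleWord,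
        List.map_cons, List.sum_cons]

/-- The digons attach the boundary circles to the sides of the triangles. -/
lemma exists_digons (L : List G) : ∃ WW : List (List (Letter G)),
    (∀ W ∈ WW, IsPolygon W) ∧ WW.length = L.length ∧ WW.flatten.length = 2 * L.length ∧
      wordBdry WW.flatten = L ∧ wordEdges WW.flatten = -listChain ℤ L := by
  induction L with
  | nil => exact ⟨[], by simp⟩
  | cons g L ih =>
    obtain ⟨WW, hpoly, hcard, hlen, hbdry, hedges⟩ := ih
    refine ⟨[.inl (g, false), .inr g] :: WW, List.forall_mem_cons.2 ⟨⟨?_, le_rfl⟩, hpoly⟩,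
      by simp [hcard], ?_, by simp [hbdry], ?_⟩
    · simp [Letter.val]
    · simp only [List.flatten_cons, List.length_append, List.length_cons, List.length_nil, hlen]
      omega
    · simp [hedges, Letter.edge, add_comm]

lemma commLengthSum_le_of_barBd_eq (z : G × G →₀ ℤ) (L : List G)
    (h : barBd G ℤ z = listChain ℤ L) :
    ∃ k : ℕ, 4 * (k : ℤ) ≤ norm1 z + 2 * L.length ∧ commLengthSum L ≤ k := by
  obtain ⟨TT, htri, hlen, hedges⟩ := exists_triangles z
  obtain ⟨BB, hBB, hBcard, hBlen, hBbdry, hBedges⟩ := exists_digons L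
  have hTlen : TT.flatten.length = 3 * TT.length := by
    rw [List.length_flatten, List.sum_eq_card_nsmul _ 3 fun n hn => ?_, List.length_map,
      smul_eq_mul, mul_comm]
    obtain ⟨W, hW, rfl⟩ := List.mem_map.1 hn
    obtain ⟨p, ε, rfl⟩ := htri W hW
    exact length_triangleWord p ε
  have hTbdry : wordBdry TT.flatten = [] := by
    rw [wordBdry_flatten, List.flatten_eq_nil_iff]
    rintro _ hn
    obtain ⟨W, hW, rfl⟩ := List.mem_map.1 hn
    obtain ⟨p, ε, rfl⟩ := htri W hW
    exact wordBdry_triangleWord p ε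
  have hpoly : ∀ W ∈ TT ++ BB, IsPolygon W := by
    intro W hW
    obtain hW | hW := List.mem_append.1 hW
    · obtain ⟨p, ε, rfl⟩ := htri W hW
      exact ⟨wordVal_triangleWord p ε, by rw [length_triangleWord]; omega⟩
    · exact hBB W hW
  obtain ⟨k, hk, hcost⟩ := gluesToSurface (TT ++ BB) hpoly (by
    rw [List.flatten_append, wordEdges_append, hedges, hBedges, h, add_neg_cancel])
  rw [List.flatten_append, wordBdry_append, hTbdry, hBbdry, List.nil_append] at hk hcost
  refine ⟨k, ?_, hcost⟩
  simp only [List.length_append, hTlen, hBlen, hBcard] at hk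
  omega

lemma commLengthSum_pow_cons_le (n : ℕ) (g : G) (L : List G) :
    commLengthSum (g ^ n :: L) ≤ commLengthSum (List.replicate n g ++ L) + n := by
  induction n generalizing L with
  | zero => simpa using (commLengthSum_one_cons L).le
  | succ n ih =>
    calc commLengthSum (g ^ (n + 1) :: L)
        ≤ commLengthSum (g ^ n :: g :: L) + 1 := by
          rw [pow_succ]
          exact commLengthSum_mul_cons_le _ _ _
      _ ≤ commLengthSum (List.replicate n g ++ g :: L) + n + 1 := by
          gcongr
          exact ih _
      _ = commLengthSum (List.replicate (n + 1) g ++ L) + (n + 1 : ℕ) := by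
          rw [commLengthSum_perm List.perm_middle, ← List.cons_append, ← List.replicate_succ,
            Nat.cast_add, Nat.cast_one, add_assoc]

lemma commLengthSum_map_pow_append_le (n : ℕ) (L M : List G) :
    commLengthSum (L.map (· ^ n) ++ M) ≤
      commLengthSum (L.flatMap (List.replicate n) ++ M) + (n * L.length : ℕ) := by
  induction L generalizing M with
  | nil => simp
  | cons g L ih =>
    calc commLengthSum (g ^ n :: (L.map (· ^ n) ++ M))
        ≤ commLengthSum (List.replicate n g ++ (L.map (· ^ n) ++ M)) + n :=
          commLengthSum_pow_cons_le _ _ _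
      _ = commLengthSum (L.map (· ^ n) ++ (List.replicate n g ++ M)) + n := by
          rw [← List.append_assoc, ← List.append_assoc,
            commLengthSum_perm (List.perm_append_comm.append_right M)]
      _ ≤ commLengthSum (L.flatMap (List.replicate n) ++ (List.replicate n g ++ M)) +
            (n * L.length : ℕ) + n := by
          gcongr
          exact ih _
      _ = _ := by
          rw [← List.append_assoc, commLengthSum_perm (List.perm_append_comm.append_right M),
            List.flatMap_cons, add_assoc, ← Nat.cast_add, List.length_cons, mul_add_one]

lemma exists_int_multiple {S : Type*} (b : S →₀ ℚ) :
    ∃ D : ℕ, 0 < D ∧ ∃ z : S →₀ ℤ,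
      Finsupp.mapRange.addMonoidHom (Int.castRingHom ℚ : ℤ →+ ℚ) z = D • b := by
  induction b using Finsupp.induction_linear with
  | zero => exact ⟨1, one_pos, 0, by simp⟩
  | add a b ha hb =>
    obtain ⟨D, hD, y, hy⟩ := ha
    obtain ⟨E, hE, z, hz⟩ := hb
    refine ⟨D * E, Nat.mul_pos hD hE, E • y + D • z, ?_⟩
    rw [map_add, map_nsmul, map_nsmul, hy, hz]
    module
  | single s r =>
    refine ⟨r.den, r.den_pos, Finsupp.single s r.num, ?_⟩
    simp [Finsupp.mapRange_single, Rat.den_mul_eq_num]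

lemma exists_commLengthSum_pow_le {r : ℚ} {L : List G}
    (h : HasFilling (barBd G ℚ) r (listChain ℚ L)) :
    ∃ D k : ℕ, 0 < D ∧ commLengthSum (L.map (· ^ D)) ≤ k ∧
      4 * (k : ℚ) ≤ D * (r + 6 * L.length) := by
  obtain ⟨b, hb, hr⟩ := h
  obtain ⟨D, hD, z, hz⟩ := exists_int_multiple b
  have hbd : barBd G ℤ z = listChain ℤ (L.flatMap (List.replicate D)) := by
    apply Finsupp.mapRange_injective (Int.castRingHom ℚ) (map_zero _) Int.cast_injective
    have := barBd_mapRange (Int.castRingHom ℚ : ℤ →+ ℚ) z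
    rw [hz, map_nsmul, hb, ← listChain_flatMap_replicate,
      ← mapRange_listChain (Int.castRingHom ℚ)] at this
    exact this.symm
  have hnorm : ((norm1 z : ℤ) : ℚ) = D * norm1 b := by
    have hcast : norm1 ((D : ℚ) • b) = (norm1 z : ℤ) := by
      rw [Nat.cast_smul_eq_nsmul, ← hz, Finsupp.mapRange.addMonoidHom_apply,
        norm1_eq_sum _ Finsupp.support_mapRange, norm1_eq_sum z subset_rfl]
      simp
    rw [← hcast, norm1_smul, Nat.abs_cast]
  obtain ⟨k, hk, hcost⟩ := commLengthSum_le_of_barBd_eq z _ hbd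
  refine ⟨D, k + D * L.length, hD, ?_, ?_⟩
  · have hpow := commLengthSum_map_pow_append_le D L []
    rw [List.append_nil, List.append_nil] at hpow
    refine hpow.trans ?_
    push_cast
    gcongr
  · have hlen : (L.flatMap (List.replicate D)).length = D * L.length := by
      simp [List.length_flatMap, mul_comm]
    rw [hlen] at hk
    have hk' : 4 * (k : ℚ) ≤ (norm1 z : ℤ) + 2 * (D * L.length) := by exact_mod_cast hk
    have hDr : (D : ℚ) * norm1 b ≤ D * r := by gcongr
    push_cast
    linarith

end ShortProductsFromFillings

section Rationalization

lemma abs_constr_sub_le {ι : Type*} (B : Module.Basis ι ℚ ℝ) {r : ι → ℚ} {δ : ℝ}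
    (hr : ∀ i, |(r i : ℝ) - B i| ≤ δ) (x : ℝ) :
    |((B.constr ℚ r x : ℚ) : ℝ) - x| ≤ (norm1 (B.repr x) : ℚ) * δ := by
  have hx : x = ∑ i ∈ (B.repr x).support, (B.repr x i : ℝ) * B i := by
    conv_lhs => rw [← B.linearCombination_repr x]
    simp only [Finsupp.linearCombination_apply, Finsupp.sum, Rat.smul_def]
  have hfx : ((B.constr ℚ r x : ℚ) : ℝ) = ∑ i ∈ (B.repr x).support, (B.repr x i : ℝ) * r i := by
    simp [Module.Basis.constr_apply, Finsupp.sum]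
  calc |((B.constr ℚ r x : ℚ) : ℝ) - x|
      = |∑ i ∈ (B.repr x).support, (B.repr x i : ℝ) * (r i - B i)| := by
        simp only [mul_sub, Finset.sum_sub_distrib]
        rw [← hfx, ← hx]
    _ ≤ ∑ i ∈ (B.repr x).support, |(B.repr x i : ℝ)| * δ := by
        refine (Finset.abs_sum_le_sum_abs _ _).trans (Finset.sum_le_sum fun i _ => ?_)
        rw [abs_mul]
        gcongr
        exact hr i
    _ = (norm1 (B.repr x) : ℚ) * δ := by
        rw [norm1_eq_sum _ subset_rfl, ← Finset.sum_mul]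
        push_cast
        rfl

/-- A retraction of `ℝ` onto `ℚ` is determined by its values on a Hamel basis containing `1`, and
these can be chosen as close to the basis vectors as we like. -/
lemma exists_ratLinearMap_near (s : Finset ℝ) {ε : ℝ} (hε : 0 < ε) :
    ∃ f : ℝ →ₗ[ℚ] ℚ, (∀ q : ℚ, f q = q) ∧ ∀ x ∈ s, |(f x : ℝ) - x| ≤ ε := by
  have hone : LinearIndepOn ℚ id {(1 : ℝ)} := LinearIndepOn.singleton one_ne_zero
  obtain ⟨ι, B, i₁, hi₁⟩ : ∃ (ι : Type) (B : Module.Basis ι ℚ ℝ) (i : ι), B i = 1 :=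
    ⟨_, .extend hone, ⟨1, Module.Basis.subset_extend hone rfl⟩, Module.Basis.extend_apply_self _ _⟩
  set C : ℚ := ∑ x ∈ s, norm1 (B.repr x)
  have hC : (0 : ℝ) < C + 1 := by
    have : 0 ≤ C := Finset.sum_nonneg fun x _ => norm1_nonneg _
    positivity
  have hnear (i : ι) : ∃ q : ℚ, |(q : ℝ) - B i| ≤ ε / (C + 1) ∧ (B i = 1 → q = 1) := by
    by_cases hi : B i = 1
    · exact ⟨1, by simpa [hi] using (div_pos hε hC).le, fun _ => rfl⟩
    · obtain ⟨q, hq⟩ := exists_rat_near (B i) (div_pos hε hC)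
      exact ⟨q, by rw [abs_sub_comm]; exact hq.le, fun h => absurd h hi⟩
  choose r hr hr1 using hnear
  refine ⟨B.constr ℚ r, fun q => ?_, fun x hx => (abs_constr_sub_le B hr x).trans ?_⟩
  · rw [← mul_one (q : ℝ), ← Rat.smul_def, map_smul, ← hi₁, Module.Basis.constr_basis, hr1 _ hi₁,
      smul_eq_mul, mul_one]
  · calc ((norm1 (B.repr x) : ℚ) : ℝ) * (ε / (C + 1)) ≤ (C + 1) * (ε / (C + 1)) := by
          have hxC : norm1 (B.repr x) ≤ C := Finset.single_le_sum (fun x _ => norm1_nonneg _) hx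
          gcongr
          exact (Rat.cast_le.2 hxC).trans (lt_add_one _).le
      _ = ε := mul_div_cancel₀ _ hC.ne'

variable {G : Type*} [Group G]

lemma exists_rat_hasFilling {r ε : ℝ} (hε : 0 < ε) {L : List G}
    (h : HasFilling (barBd G ℝ) r (listChain ℝ L)) :
    ∃ q : ℚ, q ≤ r + ε ∧ HasFilling (barBd G ℚ) q (listChain ℚ L) := by
  classical
  obtain ⟨b, hb, hr⟩ := h
  have hcard : (0 : ℝ) < b.support.card + 1 := by positivity
  obtain ⟨f, hf, hnear⟩ := exists_ratLinearMap_near (b.support.image b) (div_pos hε hcard)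
  refine ⟨_, ?_, Finsupp.mapRange.addMonoidHom (f : ℝ →+ ℚ) b, ?_, le_rfl⟩
  · rw [Finsupp.mapRange.addMonoidHom_apply, norm1_eq_sum _ Finsupp.support_mapRange, Rat.cast_sum]
    calc ∑ p ∈ b.support, ((|f (b p)| : ℚ) : ℝ)
        ≤ ∑ p ∈ b.support, (|b p| + ε / (b.support.card + 1)) := by
          refine Finset.sum_le_sum fun p hp => ?_
          have := hnear _ (Finset.mem_image_of_mem b hp)
          rw [Rat.cast_abs]
          linarith [abs_sub_abs_le_abs_sub (f (b p) : ℝ) (b p)]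
      _ = norm1 b + b.support.card * (ε / (b.support.card + 1)) := by
          rw [Finset.sum_add_distrib, Finset.sum_const, nsmul_eq_mul]
          rfl
      _ ≤ r + (b.support.card + 1) * (ε / (b.support.card + 1)) := by
          gcongr
          linarith
      _ = r + ε := by rw [mul_div_cancel₀ _ hcard.ne']
  · rw [barBd_mapRange, hb, ← mapRange_listChain (Rat.castHom ℝ)]
    ext g
    simp [hf]

/-- Fill an integral multiple of `g₁ ^ K + ⋯ + gₘ ^ K` by triangles: the surface obtained by gluing
them bounds the commutator length of the corresponding powers, and the error terms are negligible
for large `K`. -/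
lemma sclSum_le_of_hasFilling {L : List G} {A C : ℝ}
    (h : ∀ K : ℕ, 0 < K → HasFilling (barBd G ℝ) (K * A + C) (listChain ℝ (L.map (· ^ K)))) :
    sclSum L ≤ ENNReal.ofReal (A / 4) := by
  refine ENNReal.le_of_forall_pos_le_add fun ε hε _ => ?_
  refine Filter.liminf_le_of_frequently_le' (Filter.frequently_atTop.2 fun N => ?_)
  obtain ⟨M, hM⟩ := exists_nat_gt ((C + 1 + 6 * L.length) / 4 / ε)
  set K := max (M + 1) N
  have hKpos : 0 < K := by omega
  obtain ⟨q, hq, hfill⟩ := exists_rat_hasFilling one_pos (h K hKpos)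
  obtain ⟨D, k, hD, hcost, hk⟩ := exists_commLengthSum_pow_le hfill
  refine ⟨K * D, (le_max_right (M + 1) N).trans (Nat.le_mul_of_pos_right _ hD), ?_⟩
  simp only [List.map_map, Function.comp_def, ← pow_mul, List.length_map] at hcost hk
  have hKε : (C + 1 + 6 * L.length) / 4 ≤ K * ε := by
    rw [← div_le_iff₀ (by exact_mod_cast hε)]
    exact hM.le.trans (by exact_mod_cast (by omega : M ≤ K))
  have hkreal : 4 * (k : ℝ) ≤ D * (q + 6 * L.length) := by exact_mod_cast hk
  have hbound : (k : ℝ) / (K * D : ℕ) ≤ A / 4 + ε := by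
    rw [div_le_iff₀ (by positivity)]
    have : (D : ℝ) * (q + 6 * L.length) ≤ D * (4 * (K * (A / 4 + ε))) := by
      gcongr
      linarith
    push_cast
    linarith
  calc ((commLengthSum (L.map (· ^ (K * D))) : ℕ∞) : ℝ≥0∞) / (K * D : ℕ)
      ≤ (k : ℝ≥0∞) / (K * D : ℕ) := by
        gcongr
        exact_mod_cast ENat.toENNReal_le.2 hcost
    _ = ENNReal.ofReal ((k : ℝ) / (K * D : ℕ)) := by
        rw [ENNReal.ofReal_div_of_pos (by positivity), ENNReal.ofReal_natCast,
          ENNReal.ofReal_natCast]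
    _ ≤ ENNReal.ofReal (A / 4 + ε) := ENNReal.ofReal_le_ofReal hbound
    _ ≤ ENNReal.ofReal (A / 4) + ε := by
        simpa using ENNReal.ofReal_add_le (p := A / 4) (q := (ε : ℝ))

end Rationalization

section OddPart

variable {G : Type*} [Group G] {r : ℝ} {c : G →₀ ℝ}

variable (G) in
/-- The projection of the bar chains onto those that change sign under `g ↦ g⁻¹`. It makes the
averages in `oddWindow` change sign with the direction of an edge. -/
def oddPart : (G →₀ ℝ) →ₗ[ℝ] (G →₀ ℝ) :=
  (2⁻¹ : ℝ) • (LinearMap.id - Finsupp.lmapDomain ℝ ℝ Inv.inv)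

lemma oddPart_single (g : G) :
    oddPart G (Finsupp.single g 1) =
      (2⁻¹ : ℝ) • (Finsupp.single g 1 - Finsupp.single g⁻¹ 1) := by
  simp [oddPart, Finsupp.mapDomain_single]

lemma oddPart_single_inv (g : G) :
    oddPart G (Finsupp.single g⁻¹ 1) = -oddPart G (Finsupp.single g 1) := by
  rw [oddPart_single, oddPart_single, inv_inv, ← smul_neg, neg_sub]

lemma HasFilling.oddPart (h : HasFilling (barBd G ℝ) r c) :
    HasFilling (barBd G ℝ) r (oddPart G c) := by
  refine h.map (GromovScl.oddPart G) fun ⟨x, y⟩ => ?_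
  have key := ((hasFilling_triangle (R := ℝ) x y).sub (hasFilling_triangle y⁻¹ x⁻¹)).smul 2⁻¹
  convert key using 1
  · norm_num [abs_of_pos]
  · rw [barBd_single, map_sub, map_add, oddPart_single, oddPart_single, oddPart_single, mul_inv_rev]
    module

lemma hasFilling_single_sub_oddPart (g : G) :
    HasFilling (barBd G ℝ) 1 (Finsupp.single g 1 - oddPart G (Finsupp.single g 1)) := by
  have key := ((hasFilling_triangle (R := ℝ) g g⁻¹).add hasFilling_single_one).smul 2⁻¹
  rw [mul_inv_cancel] at key
  convert key using 1
  · norm_num [abs_of_pos]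
  · rw [oddPart_single]
    module

lemma hasFilling_listChain_sub_oddPart (L : List G) :
    HasFilling (barBd G ℝ) L.length (listChain ℝ L - oddPart G (listChain ℝ L)) := by
  induction L with
  | nil => simpa using HasFilling.zero
  | cons g L ih =>
    convert ih.add (hasFilling_single_sub_oddPart g) using 1
    · simp
    · rw [listChain_cons, map_add]
      abel

end OddPart

section Averaging

variable {G : Type*} [Group G]

/-- The odd part of the average of `u ^ (t - s + m)` over `s, t < K`, without the factor `K⁻²`. -/
def oddWindow (u : G) (K : ℕ) (m : ℤ) : G →₀ ℝ :=
  ∑ s ∈ Finset.range K, ∑ t ∈ Finset.range K,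
    oddPart G (Finsupp.single (u ^ ((t : ℤ) - s + m)) 1)

lemma oddWindow_neg (u : G) (K : ℕ) (m : ℤ) : oddWindow u K (-m) = -oddWindow u K m := by
  rw [oddWindow, Finset.sum_comm, oddWindow, ← Finset.sum_neg_distrib]
  refine Finset.sum_congr rfl fun s _ => ?_
  rw [← Finset.sum_neg_distrib]
  refine Finset.sum_congr rfl fun t _ => ?_
  rw [← oddPart_single_inv, ← zpow_neg]
  congr 4
  ring

lemma oddWindow_succ_sub (u : G) (K : ℕ) (m : ℤ) :
    oddWindow u K (m + 1) - oddWindow u K m = ∑ s ∈ Finset.range K,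
      (oddPart G (Finsupp.single (u ^ (K - s + m)) 1) -
        oddPart G (Finsupp.single (u ^ (-s + m)) 1)) := by
  rw [oddWindow, oddWindow, ← Finset.sum_sub_distrib]
  refine Finset.sum_congr rfl fun s _ => ?_
  rw [← Finset.sum_sub_distrib]
  have := Finset.sum_range_sub (fun t : ℕ => oddPart G (Finsupp.single (u ^ ((t : ℤ) - s + m)) 1)) K
  simp only [Nat.cast_zero, zero_sub] at this
  rw [← this]
  refine Finset.sum_congr rfl fun t _ => ?_
  rw [Nat.cast_succ, show (t : ℤ) - s + (m + 1) = t + 1 - s + m by ring]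

/-- Increasing `m` by one shifts the window, which adds `K` terms `u ^ (K - s + m)` and removes `K`
terms `u ^ (-s + m)`; each pair differs from `u ^ K` by a triangle. -/
lemma hasFilling_oddWindow_sub (u : G) (K : ℕ) (m : ℤ) :
    HasFilling (barBd G ℝ) (|(m : ℝ)| * K)
      (oddWindow u K m - (m * K : ℝ) • oddPart G (Finsupp.single (u ^ K) 1)) := by
  set F := oddPart G (Finsupp.single (u ^ K) 1) with hF
  have hnat (n : ℕ) : HasFilling (barBd G ℝ) (n * K) (oddWindow u K n - (n * K : ℝ) • F) := by
    induction n with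
    | zero =>
      have h0 : oddWindow u K 0 = 0 := by
        rw [← self_eq_neg, ← oddWindow_neg, neg_zero]
      simpa [h0] using HasFilling.zero
    | succ n ih =>
      have hstep : HasFilling (barBd G ℝ) (∑ _s ∈ Finset.range K, (1 : ℝ))
          (∑ s ∈ Finset.range K, (oddPart G (Finsupp.single (u ^ ((K : ℤ) - s + n)) 1) -
            oddPart G (Finsupp.single (u ^ (-(s : ℤ) + n)) 1) - F)) := by
        refine HasFilling.sum _ fun s _ => ?_
        have key := (hasFilling_triangle (R := ℝ) (u ^ K) (u ^ (-(s : ℤ) + n))).oddPart.neg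
        rw [← zpow_natCast, ← zpow_add, map_sub, map_add, zpow_natCast, ← hF] at key
        convert key using 1
        rw [show (K : ℤ) - s + n = K + (-s + n) by ring]
        abel
      rw [Finset.sum_sub_distrib, ← oddWindow_succ_sub, Finset.sum_const, Finset.sum_const,
        Finset.card_range, nsmul_one, ← Nat.cast_smul_eq_nsmul ℝ] at hstep
      convert ih.add hstep using 1
      · push_cast
        ring
      · push_cast
        module
  obtain ⟨n, rfl | rfl⟩ := m.eq_nat_or_neg
  · simpa using hnat n
  · rw [oddWindow_neg]
    convert (hnat n).neg using 1
    · simp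
    · push_cast
      module

end Averaging

/-! ### Holonomy of maps from simply connected spaces -/

section Paths

open Path.Homotopic.Quotient (mk_map mk_trans trans_assoc symm_trans trans_symm refl_trans
  trans_refl)

variable {X : Type*} [TopologicalSpace X]
  {A B : Type*} [TopologicalSpace A] [TopologicalSpace B]
  [SimplyConnectedSpace A] [SimplyConnectedSpace B]

/-- An arbitrarily chosen homotopy class of paths from `x` to `y`. -/
def somePathCls [PathConnectedSpace X] (x y : X) : Path.Homotopic.Quotient x y :=
  Path.Homotopic.Quotient.mk (PathConnectedSpace.somePath x y)

/-- The homotopy class of the image under `f` of any path from `a` to `b` in a simply connected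
space. -/
def pathCls (f : C(A, X)) (a b : A) : Path.Homotopic.Quotient (f a) (f b) :=
  (somePathCls a b).map f

lemma pathCls_eq_map (f : C(A, X)) {a b : A} (p : Path.Homotopic.Quotient a b) :
    pathCls f a b = p.map f := by
  rw [pathCls, Subsingleton.elim p]

lemma pathCls_trans (f : C(A, X)) (a b c : A) :
    (pathCls f a b).trans (pathCls f b c) = pathCls f a c := by
  rw [pathCls_eq_map f ((somePathCls a b).trans (somePathCls b c))]
  simp only [pathCls, somePathCls, ← mk_map, ← mk_trans, Path.map_trans]

lemma pathCls_comp (f : C(A, X)) (h : C(B, A)) (a b : B) :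
    pathCls (f.comp h) a b = pathCls f (h a) (h b) := by
  rw [pathCls_eq_map f ((somePathCls a b).map h)]
  rfl

variable [PathConnectedSpace X] {x₀ : X}

variable (x₀) in
/-- The element of the fundamental group obtained from a homotopy class of paths by joining its
endpoints to the base point along the paths of `somePathCls`. -/
def toLoop {a b : X} (p : Path.Homotopic.Quotient a b) : FundamentalGroup X x₀ :=
  FundamentalGroup.fromPath ((somePathCls x₀ a).trans (p.trans (somePathCls x₀ b).symm))

lemma toLoop_trans {a b c : X} (p : Path.Homotopic.Quotient a b)
    (q : Path.Homotopic.Quotient b c) : toLoop x₀ (p.trans q) = toLoop x₀ q * toLoop x₀ p := by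
  rw [FundamentalGroup.mul_def]
  change (somePathCls x₀ a).trans ((p.trans q).trans (somePathCls x₀ c).symm) =
    ((somePathCls x₀ a).trans (p.trans (somePathCls x₀ b).symm)).trans
      ((somePathCls x₀ b).trans (q.trans (somePathCls x₀ c).symm))
  have h : (somePathCls x₀ b).symm.trans ((somePathCls x₀ b).trans
      (q.trans (somePathCls x₀ c).symm)) = q.trans (somePathCls x₀ c).symm := by
    rw [← trans_assoc, symm_trans, refl_trans]
  simp only [trans_assoc, h]

lemma toLoop_cast {a b a' b' : X} (p : Path.Homotopic.Quotient a b) (ha : a' = a) (hb : b' = b) :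
    toLoop x₀ (p.cast ha hb) = toLoop x₀ p := by
  subst ha hb
  simp

lemma toLoop_injective {a b : X} :
    Function.Injective (toLoop x₀ : Path.Homotopic.Quotient a b → FundamentalGroup X x₀) := by
  have h (p : Path.Homotopic.Quotient a b) :
      (somePathCls x₀ a).symm.trans ((toLoop x₀ p).toPath.trans (somePathCls x₀ b)) = p := by
    change (somePathCls x₀ a).symm.trans (((somePathCls x₀ a).trans
      (p.trans (somePathCls x₀ b).symm)).trans (somePathCls x₀ b)) = p
    rw [← trans_assoc, ← trans_assoc, symm_trans, refl_trans, trans_assoc, symm_trans, trans_refl]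
  intro p q hpq
  rw [← h p, hpq, h q]

lemma toLoop_surjective {a b : X} :
    Function.Surjective (toLoop x₀ : Path.Homotopic.Quotient a b → FundamentalGroup X x₀) := by
  intro g
  refine ⟨(somePathCls x₀ a).symm.trans (g.toPath.trans (somePathCls x₀ b)), ?_⟩
  change (somePathCls x₀ a).trans (((somePathCls x₀ a).symm.trans
    (g.toPath.trans (somePathCls x₀ b))).trans (somePathCls x₀ b).symm) = g.toPath
  rw [← trans_assoc, ← trans_assoc, trans_symm, refl_trans, trans_assoc, trans_symm, trans_refl]

lemma isConj_toLoop (g : FundamentalGroup X x₀) : IsConj g (toLoop x₀ g.toPath) := by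
  refine isConj_iff.2 ⟨(FundamentalGroup.fromPath (somePathCls x₀ x₀))⁻¹, ?_⟩
  rw [inv_inv, mul_assoc]
  change ((somePathCls x₀ x₀).trans g.toPath).trans (somePathCls x₀ x₀).symm =
    (somePathCls x₀ x₀).trans (g.toPath.trans (somePathCls x₀ x₀).symm)
  rw [trans_assoc]

variable (x₀) in
/-- The element of the fundamental group given by the image under `f` of any path from `a` to `b`.
It is multiplicative in the order `holonomy b c * holonomy a b = holonomy a c`. -/
def holonomy (f : C(A, X)) (a b : A) : FundamentalGroup X x₀ := toLoop x₀ (pathCls f a b)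

lemma holonomy_mul (f : C(A, X)) (a b c : A) :
    holonomy x₀ f b c * holonomy x₀ f a b = holonomy x₀ f a c := by
  rw [holonomy, holonomy, ← toLoop_trans, pathCls_trans, holonomy]

lemma holonomy_comp (f : C(A, X)) (h : C(B, A)) (a b : B) :
    holonomy x₀ (f.comp h) a b = holonomy x₀ f (h a) (h b) := by
  rw [holonomy, holonomy, pathCls_comp]

lemma holonomy_self (f : C(A, X)) (a : A) : holonomy x₀ f a a = 1 :=
  mul_eq_left.1 (holonomy_mul (x₀ := x₀) f a a a)

end Paths

section Simplices

open unitInterval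

variable {X : Type*} [TopologicalSpace X]

instance contractibleSpace_stdSimplex (n : ℕ) :
    ContractibleSpace (stdSimplex ℝ (Fin (n + 1))) :=
  (convex_stdSimplex ℝ _).contractibleSpace ⟨_, single_mem_stdSimplex ℝ 0⟩

instance locallyPathConnectedSpace_stdSimplex (n : ℕ) :
    LocallyPathConnectedSpace (stdSimplex ℝ (Fin (n + 1))) :=
  (convex_stdSimplex ℝ _).locallyPathConnectedSpace

/-- The singular simplex given by a path. -/
def pathSimplex {x y : X} (p : Path x y) : SSimplex 1 X :=
  p.toContinuousMap.comp ⟨stdSimplexHomeomorphUnitInterval, Homeomorph.continuous _⟩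

lemma pathSimplex_apply {x y : X} (p : Path x y) (v : stdSimplex ℝ (Fin 2)) :
    pathSimplex p v = p (stdSimplexHomeomorphUnitInterval v) := rfl

/-- The collapse of the square onto the triangle: the sides `t = 0` and `t = 1` are collapsed, the
side `s = 1` is mapped to the edge `02`, and the side `s = 0` to the edges `01` and `12`. -/
def squareToTriangle : C(I × I, stdSimplex ℝ (Fin 3)) where
  toFun z := ⟨![1 - z.2 - (1 - z.1) * min (z.2 : ℝ) (1 - z.2),
      2 * ((1 - z.1) * min (z.2 : ℝ) (1 - z.2)),
      z.2 - (1 - z.1) * min (z.2 : ℝ) (1 - z.2)], by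
    obtain ⟨⟨s, hs0, hs1⟩, ⟨t, ht0, ht1⟩⟩ := z
    have hm : 0 ≤ min t (1 - t) := le_min ht0 (by linarith)
    have hmt : min t (1 - t) ≤ t := min_le_left _ _
    have hmt' : min t (1 - t) ≤ 1 - t := min_le_right _ _
    refine ⟨fun k => ?_, by rw [Fin.sum_univ_three]; simp; ring⟩
    fin_cases k
    · change 0 ≤ 1 - t - (1 - s) * min t (1 - t)
      nlinarith
    · exact mul_nonneg zero_le_two (mul_nonneg (by linarith) hm)
    · change 0 ≤ t - (1 - s) * min t (1 - t)
      nlinarith⟩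
  continuous_toFun := by
    refine Continuous.subtype_mk (continuous_pi fun k => ?_) _
    fin_cases k <;> dsimp <;> fun_prop

lemma coe_squareToTriangle (s t : I) : (squareToTriangle (s, t)).1 =
    ![1 - t - (1 - s) * min (t : ℝ) (1 - t), 2 * ((1 - s) * min (t : ℝ) (1 - t)),
      t - (1 - s) * min (t : ℝ) (1 - t)] := rfl

lemma squareToTriangle_surjective : Function.Surjective squareToTriangle := by
  rintro ⟨v, hv, hv1⟩
  rw [Fin.sum_univ_three] at hv1
  have h0 := hv 0
  have h1 := hv 1
  have h2 := hv 2
  set t : ℝ := v 2 + v 1 / 2 with ht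
  have ht0 : 0 ≤ t := by positivity
  have ht1 : t ≤ 1 := by linarith
  set μ : ℝ := min t (1 - t) with hμ
  have hμ0 : 0 ≤ μ := le_min ht0 (by linarith)
  have hμv : v 1 / 2 ≤ μ := le_min (by linarith) (by linarith)
  have hs : (v 1 / 2) / μ * μ = v 1 / 2 := by
    rcases hμ0.eq_or_lt with h | h
    · rw [← h] at hμv ⊢
      linarith
    · field_simp
  refine ⟨(⟨1 - (v 1 / 2) / μ, sub_nonneg.2 (div_le_one_of_le₀ hμv hμ0), ?_⟩, ⟨t, ht0, ht1⟩),
    Subtype.ext ?_⟩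
  · rw [sub_le_self_iff]
    positivity
  · rw [coe_squareToTriangle]
    funext k
    fin_cases k <;> simp [← hμ, hs] <;> linarith

lemma eq_of_squareToTriangle_eq {s t s' t' : I}
    (h : squareToTriangle (s, t) = squareToTriangle (s', t')) :
    t = t' ∧ (s = s' ∨ t = 0 ∨ t = 1) := by
  have h0 := congrFun (congrArg Subtype.val h) 0
  have h1 := congrFun (congrArg Subtype.val h) 1
  simp only [coe_squareToTriangle, Matrix.cons_val_zero, Matrix.cons_val_one] at h0 h1
  obtain rfl : t = t' := Subtype.ext (by linarith)
  refine ⟨rfl, ?_⟩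
  by_cases hm : min (t : ℝ) (1 - t) = 0
  · right
    rcases min_choice (t : ℝ) (1 - t) with h | h
    · exact .inl (Subtype.ext (h.symm.trans hm))
    · exact .inr (Subtype.ext (sub_eq_zero.1 (h.symm.trans hm)).symm)
  · left
    have := mul_right_cancel₀ hm (mul_left_cancel₀ two_ne_zero h1)
    exact Subtype.ext (by linarith)

lemma coe_map_succAbove (i : Fin 3) (v : stdSimplex ℝ (Fin 2)) :
    (stdSimplex.map (S := ℝ) i.succAbove v).1 =
      match i with
      | 0 => ![0, v.1 0, v.1 1]
      | 1 => ![v.1 0, 0, v.1 1]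
      | 2 => ![v.1 0, v.1 1, 0] := by
  funext k
  change FunOnFinite.linearMap ℝ ℝ i.succAbove v.1 k = _
  rw [FunOnFinite.linearMap_apply_apply, Finset.sum_filter, Fin.sum_univ_two]
  fin_cases i <;> fin_cases k <;> simp [Fin.succAbove, Fin.lt_def, Fin.ext_iff]

lemma map_succAbove_zero_eq_squareToTriangle {v : stdSimplex ℝ (Fin 2)} {t : I}
    (ht : (t : ℝ) = (1 + v.1 1) / 2) :
    stdSimplex.map (Fin.succAbove 0) v = squareToTriangle (0, t) := by
  refine Subtype.ext ((coe_map_succAbove 0 v).trans ?_)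
  have hv : v.1 0 + v.1 1 = 1 := stdSimplex.add_eq_one v
  have hm : min (t : ℝ) (1 - t) = 1 - t := min_eq_right (by linarith [v.2.1 1])
  rw [coe_squareToTriangle, hm]
  funext k
  fin_cases k <;> simp [ht] <;> linarith

lemma map_succAbove_one_eq_squareToTriangle (v : stdSimplex ℝ (Fin 2)) :
    stdSimplex.map (Fin.succAbove 1) v =
      squareToTriangle (1, stdSimplexHomeomorphUnitInterval v) := by
  refine Subtype.ext ((coe_map_succAbove 1 v).trans ?_)
  have hv : v.1 0 = 1 - v.1 1 := eq_sub_of_add_eq (stdSimplex.add_eq_one v)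
  rw [coe_squareToTriangle]
  funext k
  fin_cases k <;> simp [hv]

lemma map_succAbove_two_eq_squareToTriangle {v : stdSimplex ℝ (Fin 2)} {t : I}
    (ht : (t : ℝ) = v.1 1 / 2) :
    stdSimplex.map (Fin.succAbove 2) v = squareToTriangle (0, t) := by
  refine Subtype.ext ((coe_map_succAbove 2 v).trans ?_)
  have hv : v.1 0 + v.1 1 = 1 := stdSimplex.add_eq_one v
  have hm : min (t : ℝ) (1 - t) = t := min_eq_left (by linarith [v.2.1 0])
  rw [coe_squareToTriangle, hm]
  funext k
  fin_cases k <;> simp [ht] <;> linarith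

lemma trans_apply_of_eq_half {x y z : X} (p : Path x y) (q : Path y z) {s t : I}
    (h : (s : ℝ) = t / 2) : (p.trans q) s = p t := by
  rw [Path.trans_apply, dif_pos (by linarith [t.2.2])]
  congr 1
  exact Subtype.ext (by change 2 * (s : ℝ) = t; linarith)

lemma trans_apply_of_eq_one_add_half {x y z : X} (p : Path x y) (q : Path y z) {s t : I}
    (h : (s : ℝ) = (1 + t) / 2) : (p.trans q) s = q t := by
  have h' := trans_apply_of_eq_half q.symm p.symm (s := σ s) (t := σ t)
    (by rw [coe_symm_eq, coe_symm_eq]; linarith)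
  simpa only [← Path.trans_symm, Path.symm_apply, Function.comp_apply, symm_symm] using h'

lemma exists_comp_squareToTriangle_eq {x y : X} {p q : Path x y} (H : p.Homotopy q) :
    ∃ f : SSimplex 2 X, ∀ s t, f (squareToTriangle (s, t)) = H (s, t) := by
  have hquot : Topology.IsQuotientMap squareToTriangle :=
    squareToTriangle.continuous.isClosedMap.isQuotientMap squareToTriangle.continuous
      squareToTriangle_surjective
  have hfac : Function.FactorsThrough H.toContinuousMap squareToTriangle := by
    rintro ⟨s, t⟩ ⟨s', t'⟩ h
    obtain ⟨rfl, rfl | rfl | rfl⟩ := eq_of_squareToTriangle_eq h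
    · rfl
    · exact (H.source s).trans (H.source s').symm
    · exact (H.target s).trans (H.target s').symm
  exact ⟨hquot.lift H.toContinuousMap hfac,
    fun s t => DFunLike.congr_fun (hquot.lift_comp H.toContinuousMap hfac) (s, t)⟩

lemma exists_simplex_of_homotopic {x y z : X} {p : Path x y} {q : Path y z} {r : Path x z}
    (h : (p.trans q).Homotopic r) : ∃ f : SSimplex 2 X,
      face 0 f = pathSimplex q ∧ face 1 f = pathSimplex r ∧ face 2 f = pathSimplex p := by
  obtain ⟨H⟩ := h
  obtain ⟨f, hf⟩ := exists_comp_squareToTriangle_eq H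
  refine ⟨f, ?_, ?_, ?_⟩ <;> ext v <;> rw [pathSimplex_apply] <;>
    set u : I := stdSimplexHomeomorphUnitInterval v
  · let t : I := ⟨(1 + u) / 2, by linarith [u.2.1], by linarith [u.2.2]⟩
    change f (stdSimplex.map (Fin.succAbove 0) v) = _
    rw [map_succAbove_zero_eq_squareToTriangle (t := t) rfl, hf, H.apply_zero]
    exact trans_apply_of_eq_one_add_half p q rfl
  · change f (stdSimplex.map (Fin.succAbove 1) v) = _
    rw [map_succAbove_one_eq_squareToTriangle, hf, H.apply_one]
    rfl
  · let t : I := ⟨u / 2, by linarith [u.2.1], by linarith [u.2.2]⟩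
    change f (stdSimplex.map (Fin.succAbove 2) v) = _
    rw [map_succAbove_two_eq_squareToTriangle (t := t) rfl, hf, H.apply_zero]
    exact trans_apply_of_eq_half p q rfl

/-- The affine simplex with given vertices in a topological vector space. -/
def affineSimplex {V : Type*} [AddCommGroup V] [Module ℝ V] [TopologicalSpace V]
    [ContinuousAdd V] [ContinuousSMul ℝ V] {n : ℕ} (a : Fin (n + 1) → V) : SSimplex n V where
  toFun v := ∑ k, v.1 k • a k
  continuous_toFun := continuous_finsetSum _ fun k _ =>
    ((continuous_apply k).comp continuous_subtype_val).smul continuous_const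

lemma face_affineSimplex {V : Type*} [AddCommGroup V] [Module ℝ V] [TopologicalSpace V]
    [ContinuousAdd V] [ContinuousSMul ℝ V] (a : Fin 3 → V) (i : Fin 3) :
    face i (affineSimplex a) = affineSimplex (a ∘ i.succAbove) := by
  ext v
  change ∑ k, (stdSimplex.map i.succAbove v).1 k • a k = ∑ k, v.1 k • a (i.succAbove k)
  rw [Fin.sum_univ_three, coe_map_succAbove, Fin.sum_univ_two]
  fin_cases i <;> simp [Fin.succAbove, Fin.lt_def]

lemma face_comp {Y Z : Type*} [TopologicalSpace Y] [TopologicalSpace Z] {n : ℕ} (i : Fin (n + 2))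
    (f : C(Y, Z)) (g : SSimplex (n + 1) Y) : face i (f.comp g) = f.comp (face i g) := rfl

end Simplices

section Unroll

variable {X : Type*} [TopologicalSpace X] {ι : Type*}

/-- The covering `t ↦ exp (2πit)` of the circle by the line. -/
def circleCover : C(ℝ, Circle) := Circle.exp.comp (ContinuousMap.mulLeft (2 * Real.pi))

/-- The universal covering of the `i`-th circle, with period `1`. -/
def unroll (i : ι) : C(ℝ, Circles ι) := (circleIncl i).comp circleCover

lemma unroll_apply (i : ι) (x : ℝ) : unroll i x = ⟨i, Circle.exp (2 * Real.pi * x)⟩ := rfl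

lemma unroll_periodic (i : ι) : Function.Periodic (unroll i) 1 := fun x => by
  rw [unroll_apply, unroll_apply, mul_add, mul_one, Circle.exp_add_two_pi]

lemma unroll_eq_unroll {i k : ι} {x y : ℝ} (h : unroll i x = unroll k y) :
    i = k ∧ ∃ n : ℤ, x = y + n := by
  simp only [unroll_apply, Sigma.mk.injEq, heq_eq_eq, Circle.exp_eq_exp] at h
  obtain ⟨rfl, n, hn⟩ := h
  refine ⟨rfl, n, ?_⟩
  have : 2 * Real.pi * x = 2 * Real.pi * (y + n) := by rw [hn]; ring
  exact mul_left_cancel₀ (by positivity) this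

lemma exists_lift_circles {n : ℕ} (f : SSimplex n (Circles ι)) :
    ∃ (i : ι) (θ : SSimplex n ℝ), f = (unroll i).comp θ := by
  obtain ⟨i, g, hg, hfg⟩ := f.continuous.exists_lift_sigma
  set v : stdSimplex ℝ (Fin (n + 1)) := stdSimplex.vertex 0
  obtain ⟨F, ⟨-, hF⟩, -⟩ := Circle.isCoveringMap_exp.existsUnique_continuousMap_lifts ⟨g, hg⟩ v
    (Complex.arg (g v)) (Circle.exp_arg _)
  refine ⟨i, (ContinuousMap.mulLeft (2 * Real.pi)⁻¹).comp F, ?_⟩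
  ext x : 1
  have h1 := congrFun hfg x
  have h2 := congrFun hF x
  rw [h1]
  simp only [ContinuousMap.comp_apply, unroll_apply, ContinuousMap.coe_mulLeft, Function.comp_apply,
    ContinuousMap.coe_mk] at h2 ⊢
  rw [mul_inv_cancel_left₀ (by positivity), h2]

/-- The lift of a point of `∐ S¹` to the line given by its argument in `(-π, π]`. -/
def angle (z : Circles ι) : ℝ := (2 * Real.pi)⁻¹ * Complex.arg z.2

lemma unroll_angle (z : Circles ι) : unroll z.1 (angle z) = z := by
  rw [unroll_apply, angle, mul_inv_cancel_left₀ (by positivity), Circle.exp_arg]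

/-- The `i`-th loop of `γ`, as a periodic path. -/
abbrev unrollLoop (γ : C(Circles ι, X)) (i : ι) : C(ℝ, X) := γ.comp (unroll i)

lemma unrollLoop_periodic (γ : C(Circles ι, X)) (i : ι) : Function.Periodic (unrollLoop γ i) 1 :=
  fun x => congrArg γ (unroll_periodic i x)

end Unroll

section Holonomy

variable {X : Type*} [TopologicalSpace X] [PathConnectedSpace X] {x₀ : X}

lemma holonomy_add_int {E : C(ℝ, X)} (hE : Function.Periodic E 1) (a b : ℝ) (n : ℤ) :
    holonomy x₀ E (a + n) (b + n) = holonomy x₀ E a b := by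
  have h : E.comp (ContinuousMap.addRight (n : ℝ)) = E := by
    ext x
    simpa using hE.int_mul n x
  conv_rhs => rw [← h, holonomy_comp]
  rfl

lemma holonomy_zero_int {E : C(ℝ, X)} (hE : Function.Periodic E 1) (n : ℤ) :
    holonomy x₀ E 0 n = holonomy x₀ E 0 1 ^ n := by
  have step (n : ℤ) : holonomy x₀ E 0 (n + 1 : ℤ) = holonomy x₀ E 0 1 * holonomy x₀ E 0 n := by
    rw [← holonomy_mul E 0 n, ← holonomy_add_int hE 0 1 n]
    congr 2
    · ring
    · push_cast; ring
  induction n using Int.induction_on with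
  | zero => rw [Int.cast_zero, holonomy_self, zpow_zero]
  | succ n ih => rw [step, ih, zpow_add_one, (Commute.refl _).zpow_right _]
  | pred n ih =>
    have h := step (-(n : ℤ) - 1)
    rw [sub_add_cancel, ih] at h
    rw [zpow_sub_one, (Commute.refl _).inv_right.zpow_left _ |>.eq, h, inv_mul_cancel_left]

lemma holonomy_zero_add_int {E : C(ℝ, X)} (hE : Function.Periodic E 1) (a : ℝ) (n : ℤ) :
    holonomy x₀ E 0 (a + n) = holonomy x₀ E 0 a * holonomy x₀ E 0 1 ^ n := by
  rw [← holonomy_zero_int hE, ← holonomy_mul E 0 n, ← holonomy_add_int hE 0 a n, zero_add]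

variable {ι : Type*}

variable (x₀) in
/-- The element of the fundamental group given by the `i`-th loop of `γ`. -/
def loopElt (γ : C(Circles ι, X)) (i : ι) : FundamentalGroup X x₀ :=
  holonomy x₀ (unrollLoop γ i) 0 1

lemma isConj_holonomy_of_periodic {Φ : C(ℝ × ℝ, X)} (hΦ : ∀ t x, Φ (t, x + 1) = Φ (t, x))
    (s t : ℝ) : IsConj (holonomy x₀ Φ (s, 0) (s, 1)) (holonomy x₀ Φ (t, 0) (t, 1)) := by
  let shift : C(ℝ × ℝ, ℝ × ℝ) := ⟨fun z => (z.1, z.2 + 1), by fun_prop⟩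
  have hshift : Φ.comp shift = Φ := ContinuousMap.ext fun z => hΦ z.1 z.2
  have h : holonomy x₀ Φ (s, 1) (t, 1) = holonomy x₀ Φ (s, 0) (t, 0) := by
    conv_rhs => rw [← hshift, holonomy_comp]
    simp only [shift, ContinuousMap.coe_mk, zero_add]
  refine isConj_iff.2 ⟨holonomy x₀ Φ (s, 0) (t, 0), ?_⟩
  rw [mul_inv_eq_iff_eq_mul, holonomy_mul, ← holonomy_mul Φ (s, 0) (s, 1) (t, 1), h]

lemma toLoop_loopClass (f : C(Circle, X)) (hf : f 1 = x₀) :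
    toLoop x₀ (loopClass f hf).toPath = holonomy x₀ (f.comp circleCover) 0 1 := by
  let p : Path (0 : ℝ) 1 := ⟨⟨fun t => (t : ℝ), continuous_subtype_val⟩, rfl, rfl⟩
  have hp : p.map (f.comp circleCover).continuous = (circlePath.map f.continuous).cast
      (by simp [circleCover]) (by simp [circleCover]) := rfl
  rw [holonomy, pathCls_eq_map _ (Path.Homotopic.Quotient.mk p), ← Path.Homotopic.Quotient.mk_map,
    hp, Path.Homotopic.Quotient.mk_cast, toLoop_cast]
  change toLoop x₀ (Path.Homotopic.Quotient.mk (Path.cast _ _ _)) = _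
  rw [Path.Homotopic.Quotient.mk_cast, toLoop_cast]

lemma isConj_holonomy_of_homotopic {f f' : C(Circle, X)} (h : f.Homotopic f') :
    IsConj (holonomy x₀ (f'.comp circleCover) 0 1) (holonomy x₀ (f.comp circleCover) 0 1) := by
  obtain ⟨H⟩ := h
  let Φ : C(ℝ × ℝ, X) := H.toContinuousMap.comp
    (ContinuousMap.prodMap ⟨Set.projIcc 0 1 zero_le_one, continuous_projIcc⟩ circleCover)
  let line (t : ℝ) : C(ℝ, ℝ × ℝ) := ⟨fun x => (t, x), by fun_prop⟩
  have h0 : f.comp circleCover = Φ.comp (line 0) := by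
    ext x
    simp [Φ, line]
  have h1 : f'.comp circleCover = Φ.comp (line 1) := by
    ext x
    simp [Φ, line]
  rw [h0, h1, holonomy_comp Φ (line 1), holonomy_comp Φ (line 0)]
  exact isConj_holonomy_of_periodic (fun t x => by simp [Φ, circleCover, mul_add]) 1 0

lemma isConj_loopElt {γ : C(Circles ι, X)} {i : ι} {g : FundamentalGroup X x₀}
    (h : LoopCorresponds (γ.comp (circleIncl i)) g) : IsConj g (loopElt x₀ γ i) := by
  obtain ⟨f', hf', hH, rfl⟩ := h
  refine (isConj_toLoop _).trans ?_
  have hconj := isConj_holonomy_of_homotopic (x₀ := x₀) hH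
  rwa [ContinuousMap.comp_assoc, ← toLoop_loopClass f' hf'] at hconj

end Holonomy

section Triangles

variable {R : Type*} [CommRing R] {Y : Type*} [TopologicalSpace Y]

lemma bd_triangle (σ : SSimplex 2 Y) : bd R Y 1 (Finsupp.single σ 1) =
    Finsupp.single (face 0 σ) 1 - Finsupp.single (face 1 σ) 1 + Finsupp.single (face 2 σ) 1 := by
  rw [bd_single, one_smul]
  refine (Fin.sum_univ_three _).trans ?_
  simp [sub_eq_add_neg]

end Triangles

/-! ### Straightening chains of the mapping cylinder -/

section Straightening

variable {X : Type*} [TopologicalSpace X] {ι : Type*}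

/-- The retraction of the mapping cylinder to its base. -/
def cylRetr (γ : C(Circles ι, X)) : C(Cyl γ, X) where
  toFun := Quot.lift (Sum.elim id fun p => γ p.1) (by rintro _ _ ⟨u⟩; rfl)
  continuous_toFun := continuous_quot_lift _ (by fun_prop)

variable [PathConnectedSpace X] (x₀ : X) (γ : C(Circles ι, X))

/-- The `s`-th choice of a path from the base point to a point of the mapping cylinder: for a point
on one of the circles at the top, the path is allowed to wind `s` times around the circle. -/
def framing (y : Cyl γ) (s : ℕ) : FundamentalGroup X x₀ :=
  Function.extend (cylTop γ) (fun z => holonomy x₀ (unrollLoop γ z.1) 0 (angle z + s)) 1 y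

lemma framing_cylTop (z : Circles ι) (s : ℕ) :
    framing x₀ γ (cylTop γ z) s = holonomy x₀ (unrollLoop γ z.1) 0 (angle z + s) :=
  (cylTop_injective γ).extend_apply _ _ z

/-- The straightening of the edge from `a` to `b` of a simplex in the mapping cylinder: the loop
formed with the `s`-th choice of path at `a` and the `t`-th one at `b`. -/
def straight {n : ℕ} (f : SSimplex n (Cyl γ)) (a b : stdSimplex ℝ (Fin (n + 1))) (s t : ℕ) :
    FundamentalGroup X x₀ :=
  (framing x₀ γ (f b) t)⁻¹ * holonomy x₀ ((cylRetr γ).comp f) a b * framing x₀ γ (f a) s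

lemma straight_mul {n : ℕ} (f : SSimplex n (Cyl γ)) (a b c : stdSimplex ℝ (Fin (n + 1)))
    (s t r : ℕ) :
    straight x₀ γ f b c t r * straight x₀ γ f a b s t = straight x₀ γ f a c s r := by
  simp only [straight, ← holonomy_mul ((cylRetr γ).comp f) a b c]
  group

lemma straight_face (f : SSimplex 2 (Cyl γ)) (i : Fin 3) (s t : ℕ) :
    straight x₀ γ (face i f) (stdSimplex.vertex 0) (stdSimplex.vertex 1) s t =
      straight x₀ γ f (stdSimplex.vertex (i.succAbove 0)) (stdSimplex.vertex (i.succAbove 1))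
        s t := by
  have h (a b : stdSimplex ℝ (Fin 2)) : straight x₀ γ (face i f) a b s t =
      straight x₀ γ f (stdSimplex.map i.succAbove a) (stdSimplex.map i.succAbove b) s t := by
    simp only [straight, face]
    rw [← ContinuousMap.comp_assoc, holonomy_comp]
    rfl
  rw [h, stdSimplex.map_vertex, stdSimplex.map_vertex]

/-- The chain map to chains on the fundamental group that sends an edge to the sum of its `K²`
straightenings with the first `K` choices of paths for both ends. -/
def straighten (K : ℕ) : SChain ℝ 1 (Cyl γ) →ₗ[ℝ] (FundamentalGroup X x₀ →₀ ℝ) :=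
  Finsupp.linearCombination ℝ fun f => ∑ s ∈ Finset.range K, ∑ t ∈ Finset.range K,
    Finsupp.single (straight x₀ γ f (stdSimplex.vertex 0) (stdSimplex.vertex 1) s t) 1

lemma straighten_single (K : ℕ) (f : SSimplex 1 (Cyl γ)) :
    straighten x₀ γ K (Finsupp.single f 1) = ∑ s ∈ Finset.range K, ∑ t ∈ Finset.range K,
      Finsupp.single (straight x₀ γ f (stdSimplex.vertex 0) (stdSimplex.vertex 1) s t) 1 := by
  rw [straighten, Finsupp.linearCombination_single, one_smul]

lemma smul_straighten_bd_triangle (K : ℕ) (f : SSimplex 2 (Cyl γ)) :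
    (K : ℝ) • straighten x₀ γ K (bd ℝ (Cyl γ) 1 (Finsupp.single f 1)) =
      ∑ a ∈ Finset.range K, ∑ b ∈ Finset.range K, ∑ c ∈ Finset.range K,
        (Finsupp.single (straight x₀ γ f (stdSimplex.vertex 1) (stdSimplex.vertex 2) b c) 1 +
          Finsupp.single (straight x₀ γ f (stdSimplex.vertex 0) (stdSimplex.vertex 1) a b) 1 -
          Finsupp.single (straight x₀ γ f (stdSimplex.vertex 0) (stdSimplex.vertex 2) a c) 1) := by
  simp only [bd_triangle, map_add, map_sub, straighten_single, straight_face,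
    Fin.succAbove_zero, Fin.succ_zero_eq_one, Fin.succ_one_eq_two,
    show (1 : Fin 3).succAbove 0 = 0 from rfl, show (1 : Fin 3).succAbove 1 = 2 from rfl,
    show (2 : Fin 3).succAbove 0 = 0 from rfl, show (2 : Fin 3).succAbove 1 = 1 from rfl,
    Finset.sum_sub_distrib, Finset.sum_add_distrib, Finset.sum_const, Finset.card_range,
    ← Finset.smul_sum]
  module

lemma hasFilling_straighten_bd_triangle {K : ℕ} (hK : 0 < K) (f : SSimplex 2 (Cyl γ)) :
    HasFilling (barBd _ ℝ) (K ^ 2)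
      (straighten x₀ γ K (bd ℝ (Cyl γ) 1 (Finsupp.single f 1))) := by
  have hK' : (K : ℝ) ≠ 0 := Nat.cast_ne_zero.2 hK.ne'
  let x (b c : ℕ) := straight x₀ γ f (stdSimplex.vertex 1) (stdSimplex.vertex 2) b c
  let y (a b : ℕ) := straight x₀ γ f (stdSimplex.vertex 0) (stdSimplex.vertex 1) a b
  have hsum : HasFilling (barBd _ ℝ)
      (∑ _a ∈ Finset.range K, ∑ _b ∈ Finset.range K, ∑ _c ∈ Finset.range K, (1 : ℝ))
      (∑ a ∈ Finset.range K, ∑ b ∈ Finset.range K, ∑ c ∈ Finset.range K,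
        (Finsupp.single (x b c) 1 + Finsupp.single (y a b) 1 -
          Finsupp.single (x b c * y a b) 1)) :=
    HasFilling.sum _ fun a _ => HasFilling.sum _ fun b _ => HasFilling.sum _ fun c _ =>
      hasFilling_triangle _ _
  simp only [x, y, straight_mul] at hsum
  rw [← smul_straighten_bd_triangle] at hsum
  convert hsum.smul (K : ℝ)⁻¹ using 1
  · simp only [Finset.sum_const, Finset.card_range, nsmul_eq_mul, mul_one, abs_inv, Nat.abs_cast]
    field_simp
  · rw [inv_smul_smul₀ hK']

end Straightening

section Winding

variable {ι : Type*}

/-- The number of turns around the circle that separate `x` from the lift `angle (unroll i x)`. -/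
def turns (i : ι) (x : ℝ) : ℤ := (unroll_eq_unroll (unroll_angle (unroll i x))).2.choose

lemma angle_unroll (i : ι) (x : ℝ) : angle (unroll i x) = x + turns i x :=
  (unroll_eq_unroll (unroll_angle (unroll i x))).2.choose_spec

/-- The winding number of the arc `θ`, relative to the preferred angles of its ends. -/
def winding (i : ι) (θ : SSimplex 1 ℝ) : ℤ :=
  turns i (θ (stdSimplex.vertex 0)) - turns i (θ (stdSimplex.vertex 1))

lemma winding_face (i : ι) (θ : SSimplex 2 ℝ) (k : Fin 3) : winding i (face k θ) =
    turns i (θ (stdSimplex.vertex (k.succAbove 0))) -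
      turns i (θ (stdSimplex.vertex (k.succAbove 1))) := by
  simp only [winding, face, ContinuousMap.comp_apply, ContinuousMap.coe_mk, stdSimplex.map_vertex]

lemma winding_face_alternating_sum (i : ι) (θ : SSimplex 2 ℝ) :
    winding i (face 0 θ) - winding i (face 1 θ) + winding i (face 2 θ) = 0 := by
  simp only [winding_face, Fin.succAbove_zero, Fin.succ_zero_eq_one, Fin.succ_one_eq_two,
    show (1 : Fin 3).succAbove 0 = 0 from rfl, show (1 : Fin 3).succAbove 1 = 2 from rfl,
    show (2 : Fin 3).succAbove 0 = 0 from rfl, show (2 : Fin 3).succAbove 1 = 1 from rfl]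
  ring

/-- The arc `[0, 1]`, which lifts `circleSimplex i`. -/
def unitArc : SSimplex 1 ℝ :=
  ⟨fun x => (x : Fin 2 → ℝ) 1, (continuous_apply 1).comp continuous_subtype_val⟩

lemma circleSimplex_eq (i : ι) : circleSimplex i = (unroll i).comp unitArc := rfl

lemma winding_unitArc (i : ι) : winding i unitArc = 1 := by
  have h0 : unitArc (stdSimplex.vertex 0) = 0 := by simp [unitArc]
  have h1 : unitArc (stdSimplex.vertex 1) = 1 := by simp [unitArc]
  have hangle : angle (unroll i 1) = angle (unroll i 0) := by
    rw [← unroll_periodic i 0, zero_add]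
  rw [angle_unroll, angle_unroll] at hangle
  rw [winding, h0, h1, ← Int.cast_inj (α := ℝ)]
  push_cast
  linarith

end Winding

section StraightenedCircles

variable {X : Type*} [TopologicalSpace X] [PathConnectedSpace X] (x₀ : X) {ι : Type*}
  (γ : C(Circles ι, X))

lemma framing_unroll (i : ι) (x : ℝ) (s : ℕ) : framing x₀ γ (cylTop γ (unroll i x)) s =
    holonomy x₀ (unrollLoop γ i) 0 x * loopElt x₀ γ i ^ (turns i x + s) := by
  rw [framing_cylTop, loopElt, ← holonomy_zero_add_int (unrollLoop_periodic γ i), angle_unroll,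
    Int.cast_add, Int.cast_natCast, add_assoc]
  rfl

lemma straight_unroll (i : ι) (θ : SSimplex 1 ℝ) (s t : ℕ) :
    straight x₀ γ ((cylTop γ).comp ((unroll i).comp θ)) (stdSimplex.vertex 0)
      (stdSimplex.vertex 1) s t = loopElt x₀ γ i ^ ((s : ℤ) - t + winding i θ) := by
  set a := θ (stdSimplex.vertex 0) with ha
  set b := θ (stdSimplex.vertex 1) with hb
  set E := unrollLoop γ i with hE
  have hhol : holonomy x₀ ((cylRetr γ).comp ((cylTop γ).comp ((unroll i).comp θ)))
      (stdSimplex.vertex 0) (stdSimplex.vertex 1) =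
        holonomy x₀ E 0 b * (holonomy x₀ E 0 a)⁻¹ := by
    rw [eq_mul_inv_iff_mul_eq, ← holonomy_mul E 0 a b]
    exact congrArg (· * _) (holonomy_comp E θ _ _)
  rw [straight, hhol]
  change (framing x₀ γ (cylTop γ (unroll i b)) t)⁻¹ * _ *
    framing x₀ γ (cylTop γ (unroll i a)) s = _
  rw [framing_unroll, framing_unroll, winding, ← ha, ← hb, ← hE]
  group

lemma hasFilling_oddPart_straighten_arc (K : ℕ) (i : ι) (θ : SSimplex 1 ℝ) :
    HasFilling (barBd _ ℝ) (|(winding i θ : ℝ)| * K)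
      (oddPart _ (straighten x₀ γ K
          (push ℝ 1 (cylTop γ) (Finsupp.single ((unroll i).comp θ) 1))) -
        (winding i θ * K : ℝ) • oddPart _ (Finsupp.single (loopElt x₀ γ i ^ K) 1)) := by
  convert hasFilling_oddWindow_sub (loopElt x₀ γ i) K (winding i θ) using 2
  rw [push_single, straighten_single, oddWindow, Finset.sum_comm]
  simp only [straight_unroll, map_sum]

/-- The winding numbers of the three edges add up to zero, so the main terms of the straightened
edges cancel. -/
lemma exists_hasFilling_straighten_bd_triangle (σ : SSimplex 2 (Circles ι)) :
    ∃ D : ℝ, ∀ K : ℕ, HasFilling (barBd _ ℝ) (D * K) (oddPart _ (straighten x₀ γ K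
      (push ℝ 1 (cylTop γ) (bd ℝ (Circles ι) 1 (Finsupp.single σ 1))))) := by
  obtain ⟨i, θ, rfl⟩ := exists_lift_circles σ
  refine ⟨|(winding i (face 0 θ) : ℝ)| + |(winding i (face 1 θ) : ℝ)| +
    |(winding i (face 2 θ) : ℝ)|, fun K => ?_⟩
  have hedge (k : Fin 3) := hasFilling_oddPart_straighten_arc x₀ γ K i (face k θ)
  convert ((hedge 0).sub (hedge 1)).add (hedge 2) using 1
  · ring
  have hw : (winding i (face 0 θ) : ℝ) - winding i (face 1 θ) + winding i (face 2 θ) = 0 := by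
    exact_mod_cast winding_face_alternating_sum i θ
  rw [bd_triangle, face_comp, face_comp, face_comp]
  simp only [map_add, map_sub]
  linear_combination (norm := module) (K * hw) •
    oddPart (FundamentalGroup X x₀) (Finsupp.single (loopElt x₀ γ i ^ K) (1 : ℝ))

lemma exists_hasFilling_straighten_bd (f : SChain ℝ 2 (Circles ι)) :
    ∃ C : ℝ, ∀ K : ℕ, HasFilling (barBd _ ℝ) (C * K) (oddPart _ (straighten x₀ γ K
      (push ℝ 1 (cylTop γ) (bd ℝ (Circles ι) 1 f)))) := by
  choose D hD using exists_hasFilling_straighten_bd_triangle x₀ γ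
  refine ⟨f.sum fun σ r => |r| * D σ, fun K => ?_⟩
  have h := HasFilling.apply_boundary (oddPart _ ∘ₗ straighten x₀ γ K ∘ₗ push ℝ 1 (cylTop γ))
    (fun σ => hD σ K) f
  simpa only [Finsupp.sum, Finset.sum_mul, mul_assoc, LinearMap.comp_apply] using h

lemma hasFilling_straighten_circlesCycle [Fintype ι] (K : ℕ) :
    HasFilling (barBd _ ℝ) (Fintype.card ι * K : ℝ)
      (oddPart _ (straighten x₀ γ K (push ℝ 1 (cylTop γ) (circlesCycle ℝ ι))) -
        (K : ℝ) • oddPart _ (listChain ℝ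
          ((Finset.univ.toList.map (loopElt x₀ γ)).map (· ^ K)))) := by
  have hcircle (i : ι) := hasFilling_oddPart_straighten_arc x₀ γ K i unitArc
  simp only [winding_unitArc, ← circleSimplex_eq, Int.cast_one, abs_one, one_mul] at hcircle
  convert HasFilling.sum Finset.univ fun i _ => hcircle i using 1
  · simp
  · rw [List.map_map, listChain_map_univ]
    simp only [circlesCycle, map_sum, Finset.sum_sub_distrib, Finset.smul_sum,
      Function.comp_apply]

variable [Fintype ι]

/-- The filling of the straightened boundary of `a` has norm at most `K² * ‖a‖`, while the
straightened circles are, up to `O(K)`, `K` times the sum of the `K`-th powers. -/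
lemma exists_hasFilling_listChain_pow {a : SChain ℝ 2 (Cyl γ)} {f : SChain ℝ 2 (Circles ι)}
    (h : bd ℝ (Cyl γ) 1 a =
      push ℝ 1 (cylTop γ) (circlesCycle ℝ ι + bd ℝ (Circles ι) 1 f)) :
    ∃ C : ℝ, ∀ K : ℕ, 0 < K → HasFilling (barBd _ ℝ) (K * norm1 a + C)
      (listChain ℝ ((Finset.univ.toList.map (loopElt x₀ γ)).map (· ^ K))) := by
  obtain ⟨C, hC⟩ := exists_hasFilling_straighten_bd x₀ γ f
  refine ⟨C + 2 * Fintype.card ι, fun K hK => ?_⟩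
  set L := (Finset.univ.toList.map (loopElt x₀ γ)).map (· ^ K) with hL
  have hlen : L.length = Fintype.card ι := by simp [hL]
  have hK' : (K : ℝ) ≠ 0 := Nat.cast_ne_zero.2 hK.ne'
  have hbd : HasFilling (barBd _ ℝ) (K ^ 2 * norm1 a)
      (oddPart _ (straighten x₀ γ K (bd ℝ (Cyl γ) 1 a))) := by
    have hsum := HasFilling.apply_boundary (oddPart _ ∘ₗ straighten x₀ γ K)
      (fun σ => (hasFilling_straighten_bd_triangle x₀ γ hK σ).oddPart) a
    rwa [← Finsupp.sum_mul, mul_comm] at hsum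
  have hsmul := ((hbd.sub (hC K)).sub (hasFilling_straighten_circlesCycle x₀ γ K)).smul (K : ℝ)⁻¹
  convert hsmul.add (hasFilling_listChain_sub_oddPart L) using 1
  · rw [hlen, abs_inv, Nat.abs_cast]
    field_simp
    ring
  · rw [h, map_add, map_add, map_add, add_sub_cancel_right, sub_sub_cancel, inv_smul_smul₀ hK',
      add_sub_cancel]

end StraightenedCircles

/-! ### The Gromov seminorm bounds stable commutator length -/

section Seminorm

variable {Y : Type*} [TopologicalSpace Y]

lemma l1Norm_eq_ofReal_norm1 {n : ℕ} (a : SChain ℝ n Y) :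
    l1Norm a = ENNReal.ofReal (norm1 a) := by
  rw [l1Norm, norm1, Finsupp.sum, Finsupp.sum, ENNReal.ofReal_sum_of_nonneg]
  exact fun _ _ => abs_nonneg _

lemma norm1_toRealChain {n : ℕ} (a : SChain ℚ n Y) : norm1 (toRealChain n a) = norm1 a := by
  have hsupp : (toRealChain n a).support ⊆ a.support :=
    Finsupp.support_mapRange (hf := map_zero _)
  rw [norm1_eq_sum _ hsupp, norm1, Finsupp.sum]
  push_cast
  rfl

variable {X : Type*} [TopologicalSpace X] {ι : Type*} {γ : C(Circles ι, X)}

lemma gromovNorm_relClass_le (a : relCycles ℚ 1 (cylTop γ)) :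
    gromovNorm γ (relClass ℚ 1 (cylTop γ) a) ≤
      ENNReal.ofReal (norm1 (a : SChain ℚ 2 (Cyl γ)) : ℚ) := by
  refine iInf₂_le_of_le (toRealCycle 1 (cylTop γ) a) rfl (le_of_eq ?_)
  rw [l1Norm_eq_ofReal_norm1]
  exact congrArg ENNReal.ofReal (norm1_toRealChain _)

variable [Fintype ι]

lemma boundary_relClass_eq_iff (a : relCycles ℚ 1 (cylTop γ)) :
    H2.boundary ℚ γ (relClass ℚ 1 (cylTop γ) a) = circlesClass ℚ ι ↔
      ∃ f, bdInSub ℚ 1 (cylTop_injective γ) a = circlesCycle ℚ ι + bd ℚ (Circles ι) 1 f := by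
  have hboundary : H2.boundary ℚ γ (relClass ℚ 1 (cylTop γ) a) =
      Submodule.Quotient.mk ⟨bdInSub ℚ 1 (cylTop_injective γ) a, bd_bdInSub ℚ 0 _ a⟩ := rfl
  rw [hboundary, circlesClass, Submodule.Quotient.eq]
  exact exists_congr fun f => by rw [eq_comm, ← sub_eq_iff_eq_add']; rfl

lemma exists_gromovNorm_le_of_hasFilling {r : ℚ} {f : SChain ℚ 2 (Circles ι)}
    (h : HasFilling (bd ℚ (Cyl γ) 1) r
      (push ℚ 1 (cylTop γ) (circlesCycle ℚ ι + bd ℚ (Circles ι) 1 f))) :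
    ∃ α : H2 ℚ γ, H2.boundary ℚ γ α = circlesClass ℚ ι ∧
      gromovNorm γ α ≤ ENNReal.ofReal r := by
  obtain ⟨a, ha, hr⟩ := h
  let a' : relCycles ℚ 1 (cylTop γ) := ⟨a, _, ha.symm⟩
  have hbd : bdInSub ℚ 1 (cylTop_injective γ) a' = circlesCycle ℚ ι + bd ℚ (Circles ι) 1 f :=
    push_injective ℚ (cylTop_injective γ) ((push_bdInSub ℚ 1 (cylTop_injective γ) a').trans ha)
  refine ⟨relClass ℚ 1 (cylTop γ) a', (boundary_relClass_eq_iff a').2 ⟨f, hbd⟩,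
    (gromovNorm_relClass_le a').trans (ENNReal.ofReal_le_ofReal ?_)⟩
  exact_mod_cast hr

lemma toRealChain_circlesCycle : toRealChain 1 (circlesCycle ℚ ι) = circlesCycle ℝ ι := by
  simp [circlesCycle, toRealChain_single]

lemma exists_bd_toRealChain_eq {q : relCycles ℚ 1 (cylTop γ)}
    (hq : H2.boundary ℚ γ (relClass ℚ 1 (cylTop γ) q) = circlesClass ℚ ι) :
    ∃ f, bd ℝ (Cyl γ) 1 (toRealChain 2 (q : SChain ℚ 2 (Cyl γ))) =
      push ℝ 1 (cylTop γ) (circlesCycle ℝ ι + bd ℝ (Circles ι) 1 f) := by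
  obtain ⟨f, hf⟩ := (boundary_relClass_eq_iff q).1 hq
  refine ⟨toRealChain 2 f, ?_⟩
  rw [bd_toRealChain, ← push_bdInSub ℚ 1 (cylTop_injective γ) q, hf, ← push_toRealChain,
    map_add (toRealChain 1), toRealChain_circlesCycle, ← bd_toRealChain]

lemma exists_bd_eq_of_relClass_eq {a : relCycles ℝ 1 (cylTop γ)} {α : H2 ℚ γ}
    (hα : H2.boundary ℚ γ α = circlesClass ℚ ι)
    (ha : relClass ℝ 1 (cylTop γ) a = toRealClass 1 (cylTop γ) α) :
    ∃ f, bd ℝ (Cyl γ) 1 (a : SChain ℝ 2 (Cyl γ)) =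
      push ℝ 1 (cylTop γ) (circlesCycle ℝ ι + bd ℝ (Circles ι) 1 f) := by
  obtain ⟨q, rfl⟩ : ∃ q, relClass ℚ 1 (cylTop γ) q = α := Submodule.mkQ_surjective _ α
  obtain ⟨f, hf⟩ := exists_bd_toRealChain_eq hα
  have hsub : (a : SChain ℝ 2 (Cyl γ)) - toRealChain 2 (q : SChain ℚ 2 (Cyl γ)) ∈
      relBoundaries ℝ 1 (cylTop γ) :=
    (Submodule.Quotient.eq ((relBoundaries ℝ 1 (cylTop γ)).comap
      (relCycles ℝ 1 (cylTop γ)).subtype)).1 ha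
  obtain ⟨_, ⟨b, rfl⟩, _, ⟨e, rfl⟩, hbe⟩ := Submodule.mem_sup.1 hsub
  refine ⟨f + e, ?_⟩
  calc bd ℝ (Cyl γ) 1 (a : SChain ℝ 2 (Cyl γ))
      = bd ℝ (Cyl γ) 1 (toRealChain 2 (q : SChain ℚ 2 (Cyl γ)) +
          (bd ℝ (Cyl γ) 2 b + push ℝ 2 (cylTop γ) e)) := by rw [hbe, add_sub_cancel]
    _ = push ℝ 1 (cylTop γ) (circlesCycle ℝ ι + bd ℝ (Circles ι) 1 f) +
          push ℝ 1 (cylTop γ) (bd ℝ (Circles ι) 1 e) := by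
        rw [map_add, map_add, hf, bd_bd, zero_add, bd_push]
    _ = _ := by rw [← map_add, add_assoc, ← map_add]

variable [PathConnectedSpace X] (x₀ : X)

lemma sclSum_loopElt_le_gromovNorm {α : H2 ℚ γ} (hα : H2.boundary ℚ γ α = circlesClass ℚ ι) :
    sclSum (Finset.univ.toList.map (loopElt x₀ γ)) ≤ 1 / 4 * gromovNorm γ α := by
  simp only [gromovNorm, l1Seminorm, ENNReal.mul_iInf_of_ne (a := 1 / 4) (by simp) (by simp)]
  refine le_iInf₂ fun a ha => ?_
  obtain ⟨f, hf⟩ := exists_bd_eq_of_relClass_eq hα ha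
  obtain ⟨C, hC⟩ := exists_hasFilling_listChain_pow x₀ γ hf
  refine (sclSum_le_of_hasFilling hC).trans_eq ?_
  rw [l1Norm_eq_ofReal_norm1, div_eq_inv_mul, ENNReal.ofReal_mul (by norm_num), one_div,
    ENNReal.ofReal_inv_of_pos (by norm_num), ENNReal.ofReal_ofNat]

end Seminorm

/-! ### Stable commutator length bounds the Gromov seminorm -/

section AffineTriangles

variable {R : Type*} [CommRing R] {Y : Type*} [TopologicalSpace Y]
  {V : Type*} [AddCommGroup V] [Module ℝ V] [TopologicalSpace V] [ContinuousAdd V]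
  [ContinuousSMul ℝ V]

lemma bd_comp_affineSimplex (f : C(V, Y)) (a b c : V) :
    bd R Y 1 (Finsupp.single (f.comp (affineSimplex ![a, b, c])) 1) =
      Finsupp.single (f.comp (affineSimplex ![b, c])) 1 -
        Finsupp.single (f.comp (affineSimplex ![a, c])) 1 +
        Finsupp.single (f.comp (affineSimplex ![a, b])) 1 := by
  have h0 : ![a, b, c] ∘ (0 : Fin 3).succAbove = ![b, c] := by ext k; fin_cases k <;> rfl
  have h1 : ![a, b, c] ∘ (1 : Fin 3).succAbove = ![a, c] := by ext k; fin_cases k <;> rfl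
  have h2 : ![a, b, c] ∘ (2 : Fin 3).succAbove = ![a, b] := by ext k; fin_cases k <;> rfl
  rw [bd_triangle]
  simp only [face_comp, face_affineSimplex, h0, h1, h2]

lemma affineSimplex_edge_apply (a b : V) (v : stdSimplex ℝ (Fin 2)) :
    affineSimplex ![a, b] v = v.1 0 • a + v.1 1 • b := by
  change ∑ k, v.1 k • ![a, b] k = _
  simp [Fin.sum_univ_two]

end AffineTriangles

section MultiLoops

variable {ι : Type*}

/-- The singular simplex running `n` times around the `i`-th circle. -/
def multiLoop (i : ι) (n : ℕ) : SSimplex 1 (Circles ι) :=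
  (unroll i).comp (affineSimplex ![(0 : ℝ), n])

lemma unroll_comp_affineSimplex_succ (i : ι) (n : ℕ) :
    (unroll i).comp (affineSimplex ![(n : ℝ), n + 1]) = circleSimplex i := by
  ext v : 1
  have hv : v.1 0 + v.1 1 = 1 := stdSimplex.add_eq_one v
  have hedge : v.1 0 • (n : ℝ) + v.1 1 • ((n : ℝ) + 1) = v.1 1 + n * 1 := by
    simp only [smul_eq_mul]
    linear_combination (n : ℝ) * hv
  rw [ContinuousMap.comp_apply, affineSimplex_edge_apply, hedge,
    (unroll_periodic i).nat_mul n (v.1 1)]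
  rfl

lemma exists_multiLoop_eq (R : Type*) [CommRing R] (i : ι) (n : ℕ) :
    ∃ f, Finsupp.single (multiLoop i n) (1 : R) =
      (n : R) • Finsupp.single (circleSimplex i) 1 + bd R (Circles ι) 1 f := by
  induction n with
  | zero =>
    refine ⟨Finsupp.single ((unroll i).comp (affineSimplex ![(0 : ℝ), 0, 0])) 1, ?_⟩
    rw [bd_comp_affineSimplex]
    simp [multiLoop]
  | succ n ih =>
    obtain ⟨f, hf⟩ := ih
    refine ⟨f - Finsupp.single ((unroll i).comp (affineSimplex ![(0 : ℝ), n, n + 1])) 1, ?_⟩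
    have hbd := bd_comp_affineSimplex (R := R) (unroll i) 0 n (n + 1)
    rw [unroll_comp_affineSimplex_succ, ← Nat.cast_succ] at hbd
    rw [map_sub, ← Nat.cast_succ, hbd]
    change Finsupp.single (multiLoop i (n + 1)) 1 = _ + (_ - (_ -
      Finsupp.single (multiLoop i (n + 1)) 1 + Finsupp.single (multiLoop i n) 1))
    rw [hf, Nat.cast_succ, add_smul, one_smul]
    abel

end MultiLoops

section SingularFillings

variable {R : Type*} [CommRing R] [LinearOrder R] [IsStrictOrderedRing R]
  {Y Z : Type*} [TopologicalSpace Y] [TopologicalSpace Z]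

lemma HasFilling.push {r : R} {c : SChain R 1 Y} (f : C(Y, Z)) (h : HasFilling (bd R Y 1) r c) :
    HasFilling (bd R Z 1) r (push R 1 f c) :=
  h.map _ fun σ => by
    rw [← bd_push, push_single]
    exact boundary_single _ _

end SingularFillings

section Strip

variable {X : Type*} [TopologicalSpace X] {ι : Type*} (γ : C(Circles ι, X))

/-- The inclusion of the base of the mapping cylinder. -/
def cylBase : C(X, Cyl γ) where
  toFun x := Quot.mk _ (Sum.inl x)
  continuous_toFun := continuous_quot_mk.comp (by fun_prop)

/-- The universal cover of the `i`-th cylinder, extended to a map on the plane. -/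
def strip (i : ι) : C(ℝ × ℝ, Cyl γ) where
  toFun z := Quot.mk _ (Sum.inr (unroll i z.1, Set.projIcc 0 1 zero_le_one z.2))
  continuous_toFun := continuous_quot_mk.comp <| continuous_inr.comp <|
    ((unroll i).continuous.comp continuous_fst).prodMk (continuous_projIcc.comp continuous_snd)

lemma strip_one (i : ι) (x : ℝ) : strip γ i (x, 1) = cylTop γ (unroll i x) := by
  simp [strip, cylTop]

lemma strip_zero (i : ι) (x : ℝ) : strip γ i (x, 0) = cylBase γ (γ (unroll i x)) := by
  refine Eq.trans ?_ (Quot.sound (CylRel.glue _))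
  simp [strip]

lemma strip_natCast (i : ι) (n : ℕ) (t : ℝ) : strip γ i (n, t) = strip γ i (0, t) := by
  have h := (unroll_periodic i).nat_mul_eq n
  rw [mul_one] at h
  simp only [strip, ContinuousMap.coe_mk, h]

lemma strip_comp_horizontal (i : ι) (a b t : ℝ) (v : stdSimplex ℝ (Fin 2)) :
    strip γ i (affineSimplex ![(a, t), (b, t)] v) = strip γ i (affineSimplex ![a, b] v, t) := by
  have hv : v.1 0 + v.1 1 = 1 := stdSimplex.add_eq_one v
  rw [affineSimplex_edge_apply, affineSimplex_edge_apply]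
  congr 1
  ext
  · rfl
  · simp [← add_mul, hv]

lemma strip_comp_vertical (i : ι) (n : ℕ) :
    (strip γ i).comp (affineSimplex ![((n : ℝ), (0 : ℝ)), ((n : ℝ), 1)]) =
      (strip γ i).comp (affineSimplex ![((0 : ℝ), (0 : ℝ)), ((0 : ℝ), 1)]) := by
  ext v : 1
  have hv : v.1 0 + v.1 1 = 1 := stdSimplex.add_eq_one v
  have hn : affineSimplex ![((n : ℝ), (0 : ℝ)), ((n : ℝ), 1)] v = ((n : ℝ), v.1 1) := by
    rw [affineSimplex_edge_apply]
    simp [← add_mul, hv]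
  have h0 : affineSimplex ![((0 : ℝ), (0 : ℝ)), ((0 : ℝ), 1)] v = ((0 : ℝ), v.1 1) := by
    rw [affineSimplex_edge_apply]
    simp
  rw [ContinuousMap.comp_apply, ContinuousMap.comp_apply, hn, h0, strip_natCast]

variable (R : Type*) [CommRing R] [LinearOrder R] [IsStrictOrderedRing R]

/-- The two triangles of the rectangle `[0, n] × [0, 1]`, whose vertical sides cancel. -/
lemma hasFilling_multiLoop_sub (i : ι) (n : ℕ) :
    HasFilling (bd R (Cyl γ) 1) 2 (Finsupp.single ((cylTop γ).comp (multiLoop i n)) 1 -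
      Finsupp.single ((cylBase γ).comp (γ.comp (multiLoop i n))) 1) := by
  have htop : (strip γ i).comp (affineSimplex ![((0 : ℝ), (1 : ℝ)), ((n : ℝ), 1)]) =
      (cylTop γ).comp (multiLoop i n) :=
    ContinuousMap.ext fun v => (strip_comp_horizontal γ i 0 n 1 v).trans (strip_one γ i _)
  have hbase : (strip γ i).comp (affineSimplex ![((0 : ℝ), (0 : ℝ)), ((n : ℝ), 0)]) =
      (cylBase γ).comp (γ.comp (multiLoop i n)) :=
    ContinuousMap.ext fun v => (strip_comp_horizontal γ i 0 n 0 v).trans (strip_zero γ i _)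
  have key := (HasFilling.boundary_single (bd R (Cyl γ) 1) ((strip γ i).comp
      (affineSimplex ![((0 : ℝ), (0 : ℝ)), ((0 : ℝ), 1), ((n : ℝ), 1)]))).sub
    (HasFilling.boundary_single (bd R (Cyl γ) 1) ((strip γ i).comp
      (affineSimplex ![((0 : ℝ), (0 : ℝ)), ((n : ℝ), 0), ((n : ℝ), 1)])))
  rw [bd_comp_affineSimplex, bd_comp_affineSimplex, htop, hbase, strip_comp_vertical] at key
  convert key using 1
  · norm_num
  · abel

end Strip

section Fillings

variable {R : Type*} [CommRing R] [LinearOrder R] [IsStrictOrderedRing R]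
  {X : Type*} [TopologicalSpace X] [PathConnectedSpace X] {x₀ : X}

open Path.Homotopic.Quotient (mk)

lemma hasFilling_pathSimplex_triangle {x y z : X} {p : Path x y} {q : Path y z} {r : Path x z}
    (h : toLoop x₀ (mk q) * toLoop x₀ (mk p) = toLoop x₀ (mk r)) :
    HasFilling (bd R X 1) 1 (Finsupp.single (pathSimplex q) 1 -
      Finsupp.single (pathSimplex r) 1 + Finsupp.single (pathSimplex p) 1) := by
  rw [← toLoop_trans, ← Path.Homotopic.Quotient.mk_trans] at h
  obtain ⟨σ, h0, h1, h2⟩ := exists_simplex_of_homotopic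
    (Path.Homotopic.Quotient.exact (toLoop_injective h))
  rw [← h0, ← h1, ← h2, ← bd_triangle]
  exact HasFilling.boundary_single _ σ

lemma exists_path_toLoop_eq (x y : X) (g : FundamentalGroup X x₀) :
    ∃ p : Path x y, toLoop x₀ (mk p) = g := by
  obtain ⟨q, hq⟩ := toLoop_surjective (a := x) (b := y) g
  obtain ⟨p, rfl⟩ := Path.Homotopic.Quotient.mk_surjective q
  exact ⟨p, hq⟩

lemma hasFilling_pathSimplex_sub {y z : X} {p : Path y y} {q : Path z z}
    (h : toLoop x₀ (mk p) = toLoop x₀ (mk q)) :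
    HasFilling (bd R X 1) 2
      (Finsupp.single (pathSimplex p) 1 - Finsupp.single (pathSimplex q) 1) := by
  obtain ⟨κ, hκ⟩ := exists_path_toLoop_eq z y (1 : FundamentalGroup X x₀)
  obtain ⟨m, hm⟩ := exists_path_toLoop_eq z y (toLoop x₀ (mk p))
  have hp := hasFilling_pathSimplex_triangle (R := R) (x₀ := x₀) (p := κ) (q := p) (r := m)
    (by rw [hκ, hm, mul_one])
  have hq := hasFilling_pathSimplex_triangle (R := R) (x₀ := x₀) (p := q) (q := κ) (r := m)
    (by rw [hκ, hm, one_mul, h])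
  convert hp.sub hq using 1
  · norm_num
  · abel

lemma HasFilling.mapDomain_pathSimplex {ρ : FundamentalGroup X x₀ → Path x₀ x₀}
    (hρ : ∀ g, toLoop x₀ (mk (ρ g)) = g) {r : R} {c : FundamentalGroup X x₀ →₀ R}
    (h : HasFilling (barBd _ R) r c) :
    HasFilling (bd R X 1) r (Finsupp.lmapDomain R R (fun g => pathSimplex (ρ g)) c) :=
  h.map _ fun ⟨a, b⟩ => by
    have key := hasFilling_pathSimplex_triangle (R := R) (x₀ := x₀) (p := ρ b) (q := ρ a)
      (r := ρ (a * b)) (by simp only [hρ])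
    rw [barBd_single, map_sub, map_add]
    simp only [Finsupp.lmapDomain_apply, Finsupp.mapDomain_single]
    convert key using 1
    abel

variable {ι : Type*} (γ : C(Circles ι, X))

lemma exists_path_multiLoop (i : ι) (n : ℕ) : ∃ (y : X) (p : Path y y),
    pathSimplex p = γ.comp (multiLoop i n) ∧ toLoop x₀ (mk p) = loopElt x₀ γ i ^ n := by
  have hper : unrollLoop γ i n = unrollLoop γ i 0 := by
    simpa using (unrollLoop_periodic γ i).nat_mul_eq n
  let l : Path (0 : ℝ) n := ⟨⟨fun t => t * n, by fun_prop⟩, by simp, by simp⟩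
  refine ⟨unrollLoop γ i 0, (l.map (unrollLoop γ i).continuous).cast rfl hper.symm, ?_, ?_⟩
  · ext v : 1
    have h : affineSimplex ![(0 : ℝ), n] v = v.1 1 * n := by
      rw [affineSimplex_edge_apply, smul_zero, zero_add, smul_eq_mul]
    exact congrArg (unrollLoop γ i) h.symm
  · rw [Path.Homotopic.Quotient.mk_cast, toLoop_cast, Path.Homotopic.Quotient.mk_map,
      ← pathCls_eq_map]
    have h := holonomy_zero_int (x₀ := x₀) (unrollLoop_periodic γ i) n
    rw [zpow_natCast] at h
    exact_mod_cast h

variable [Fintype ι]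

lemma hasFilling_sum_multiLoop {k n : ℕ}
    (h : commLengthSum ((Finset.univ.toList.map (loopElt x₀ γ)).map (· ^ n)) ≤ k) :
    HasFilling (bd R X 1) (4 * k + (5 * Fintype.card ι + 2))
      (∑ i, Finsupp.single (γ.comp (multiLoop i n)) 1) := by
  choose ρ hρ using exists_path_toLoop_eq x₀ x₀ (x₀ := x₀)
  have hloop (i : ι) : HasFilling (bd R X 1) 2 (Finsupp.single (γ.comp (multiLoop i n)) 1 -
      Finsupp.single (pathSimplex (ρ (loopElt x₀ γ i ^ n))) 1) := by
    obtain ⟨y, p, hp, hp'⟩ := exists_path_multiLoop (x₀ := x₀) γ i n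
    rw [← hp]
    exact hasFilling_pathSimplex_sub (by rw [hp', hρ])
  rw [List.map_map] at h
  have key := ((hasFilling_listChain (R := R) h).mapDomain_pathSimplex hρ).add
    (HasFilling.sum Finset.univ fun i _ => hloop i)
  simp only [listChain_map_univ, map_sum, Finsupp.lmapDomain_apply, Finsupp.mapDomain_single,
    Function.comp_apply, List.length_map, Finset.length_toList, Finset.card_univ,
    Finset.sum_const, nsmul_eq_mul, Finset.sum_sub_distrib, add_sub_cancel] at key
  convert key using 1
  ring

lemma hasFilling_push_sum_multiLoop {k n : ℕ}
    (h : commLengthSum ((Finset.univ.toList.map (loopElt x₀ γ)).map (· ^ n)) ≤ k) :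
    HasFilling (bd R (Cyl γ) 1) (4 * k + (7 * Fintype.card ι + 2))
      (push R 1 (cylTop γ) (∑ i, Finsupp.single (multiLoop i n) 1)) := by
  have key := ((hasFilling_sum_multiLoop (R := R) γ h).push (cylBase γ)).add
    (HasFilling.sum Finset.univ fun i _ => hasFilling_multiLoop_sub γ R i n)
  simp only [map_sum, push_single, Finset.sum_const, Finset.card_univ, nsmul_eq_mul,
    Finset.sum_sub_distrib, add_sub_cancel] at key ⊢
  convert key using 1
  ring

lemma exists_hasFilling_circlesCycle {k n : ℕ} (hn : n ≠ 0)
    (h : commLengthSum ((Finset.univ.toList.map (loopElt x₀ γ)).map (· ^ n)) ≤ k) :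
    ∃ f, HasFilling (bd ℚ (Cyl γ) 1) ((4 * k + (7 * Fintype.card ι + 2)) / n)
      (push ℚ 1 (cylTop γ) (circlesCycle ℚ ι + bd ℚ (Circles ι) 1 f)) := by
  have hn' : (n : ℚ) ≠ 0 := by exact_mod_cast hn
  choose f hf using fun i : ι => exists_multiLoop_eq ℚ i n
  refine ⟨(n : ℚ)⁻¹ • ∑ i, f i, ?_⟩
  convert (hasFilling_push_sum_multiLoop (R := ℚ) γ h).smul (n : ℚ)⁻¹ using 1
  · rw [abs_of_nonneg (by positivity), div_eq_inv_mul]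
  · rw [← map_smul]
    congr 1
    simp only [hf, Finset.sum_add_distrib, ← Finset.smul_sum, smul_add, map_smul, map_sum,
      inv_smul_smul₀ hn', circlesCycle]

variable (x₀) in
lemma iInf_gromovNorm_le_commLengthSum {n : ℕ} (hn : n ≠ 0) :
    ⨅ (α : H2 ℚ γ) (_ : H2.boundary ℚ γ α = circlesClass ℚ ι), gromovNorm γ α ≤
      (4 * (commLengthSum ((Finset.univ.toList.map (loopElt x₀ γ)).map (· ^ n)) : ℝ≥0∞) +
        (7 * Fintype.card ι + 2)) / n := by
  induction hk : commLengthSum ((Finset.univ.toList.map (loopElt x₀ γ)).map (· ^ n)) with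
  | top => simp [ENNReal.top_div]
  | coe k =>
    obtain ⟨f, hf⟩ := exists_hasFilling_circlesCycle γ hn hk.le
    obtain ⟨α, hα, hle⟩ := exists_gromovNorm_le_of_hasFilling hf
    refine (iInf₂_le_of_le α hα hle).trans_eq ?_
    push_cast
    rw [ENNReal.ofReal_div_of_pos (by positivity)]
    norm_cast

variable (x₀) in
lemma iInf_gromovNorm_le_sclSum :
    1 / 4 * (⨅ (α : H2 ℚ γ) (_ : H2.boundary ℚ γ α = circlesClass ℚ ι), gromovNorm γ α) ≤
      sclSum (Finset.univ.toList.map (loopElt x₀ γ)) := by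
  set B := ⨅ (α : H2 ℚ γ) (_ : H2.boundary ℚ γ α = circlesClass ℚ ι), gromovNorm γ α
  rw [← Filter.liminf_const (f := Filter.atTop (α := ℕ)) (1 / 4 * B), sclSum]
  refine liminf_le_liminf_of_le_add_div (C := 1 / 4 * (7 * Fintype.card ι + 2))
    (by finiteness) fun n => ?_
  obtain rfl | hn := eq_or_ne n 0
  · simp [ENNReal.div_zero]
  · calc 1 / 4 * B
        ≤ 1 / 4 * ((4 * (commLengthSum ((Finset.univ.toList.map (loopElt x₀ γ)).map (· ^ n)) :
            ℝ≥0∞) + (7 * Fintype.card ι + 2)) / n) := by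
          gcongr
          exact iInf_gromovNorm_le_commLengthSum x₀ γ hn
      _ = _ := by
          rw [← ENNReal.add_div, ← mul_div_assoc, mul_add, ← mul_assoc,
            one_div, ENNReal.inv_mul_cancel (by simp) (by simp), one_mul]

end Fillings

section Comparison

variable {X : Type*} [TopologicalSpace X] [PathConnectedSpace X] {x₀ : X} {ι : Type*} [Fintype ι]

lemma scl_eq_sclSum_loopElt {γ : C(Circles ι, X)} {w : ι → FundamentalGroup X x₀} {l : ι → ℤ}
    {c : FundamentalGroup X x₀ →₀ ℤ}
    (hc : conjClass (∑ i, Finsupp.single (w i) (l i)) = conjClass c)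
    (hγ : ∀ i, LoopCorresponds (γ.comp (circleIncl i)) (w i ^ l i)) :
    scl c = sclSum (Finset.univ.toList.map (loopElt x₀ γ)) := by
  rw [scl_eq_sclSum_of_conjClass_eq w l c hc]
  refine (Comparable.of_forall₂_isConj ?_).sclSum_eq
  rw [List.forall₂_map_left_iff, List.forall₂_map_right_iff, List.forall₂_same]
  exact fun i _ => isConj_loopElt (hγ i)

end Comparison

end GromovScl

end

theorem propositionA_general {X : Type*} [TopologicalSpace X] [PathConnectedSpace X] (x₀ : X)
    {ι : Type*} [Fintype ι] (γ : C(GromovScl.Circles ι, X)) (c : FundamentalGroup X x₀ →₀ ℤ)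
    (w : ι → FundamentalGroup X x₀) (l : ι → ℤ)
    (hc : GromovScl.conjClass (∑ i, Finsupp.single (w i) (l i)) = GromovScl.conjClass c)
    (hγ : ∀ i, GromovScl.LoopCorresponds (γ.comp (GromovScl.circleIncl i)) (w i ^ l i)) :
    GromovScl.scl c =
      (1 / 4) * ⨅ (α : GromovScl.H2 ℚ γ)
        (_ : GromovScl.H2.boundary ℚ γ α = GromovScl.circlesClass ℚ ι),
        GromovScl.gromovNorm γ α := by
  rw [GromovScl.scl_eq_sclSum_loopElt hc hγ]
  refine le_antisymm ?_ (GromovScl.iInf_gromovNorm_le_sclSum x₀ γ)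
  simp only [ENNReal.mul_iInf_of_ne (a := 1 / 4) (by simp) (by simp)]
  exact le_iInf₂ fun α hα => GromovScl.sclSum_loopElt_le_gromovNorm x₀ hα

theorem propositionA {X : Type*} [TopologicalSpace X] [PathConnectedSpace X] (x₀ : X)
    {ι : Type*} [Fintype ι] (γ : C(GromovScl.Circles ι, X))
    (c : FundamentalGroup X x₀ →₀ ℤ) (hγ : GromovScl.Represents γ (GromovScl.conjClass c)) :
    GromovScl.scl c =
      (1 / 4) * ⨅ (α : GromovScl.H2 ℚ γ)
        (_ : GromovScl.H2.boundary ℚ γ α = GromovScl.circlesClass ℚ ι),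
        GromovScl.gromovNorm γ α := by
  obtain ⟨w, l, -, -, hc, hγ⟩ := hγ
  exact propositionA_general x₀ γ c w l hc hγ
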